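/- Let $E$ be a real topological vector space, assumed Hausdorff but not necessarily locally convex, and write $\mathbb N=\{1,2,\dots\}$, $\mathbb N_0=\mathbb N\cup\{0\}$. Conventions. Let $U\subseteq\mathbb R$ be a non-empty set without isolated points. A map $\gamma\colon U\to E$ is $C^0$ if it is continuous, and then $\gamma^{<0>}:=\gamma$. Recursively, for $k\ge 1$, $\gamma$ is $C^k$ if it is $C^{k-1}$ and there is a (necessarily unique) continuous map $\gamma^{<k>}\colon U^{k+1}\to E$ with $$\gamma^{<k>}(x_0,\dots,x_k)=\frac{\gamma^{<k-1>}(x_k,x_1,\dots,x_{k-1})-\gamma^{<k-1>}(x_0,x_1,\dots,x_{k-1})}{x_k-x_0}\quad\text{whenever }x_0\ne x_k.$$ It is smooth if it is $C^k$ for all $k\in\mathbb N_0$, and $\gamma\in BC^\infty(U,E)$ means that $\gamma$ is smooth and $\gamma^{<k>}(U^{k+1})$ is bounded in $E$ for every $k\in\mathbb N_0$. A gauge on $E$ is a map $q\colon E\to[0,\infty[$ with $q(tx)=|t|q(x)$ for all $t\in\mathbb R$, $x\in E$, such that $\{x : q(x)<\varepsilon\}$ is a $0$-neighbourhood for every $\varepsilon>0$.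 A calibration is a sequence $(q_n)_{n\in\mathbb N_0}$ of gauges with $q_n(x+y)\le q_{n+1}(x)+q_{n+1}(y)$ for all $n\in\mathbb N_0$ and $x,y\in E$; it extends $q$ if $q_0=q$. For a gauge $q$ set $\|\gamma^{<k>}\|_{q,\infty}:=\sup\{q(\gamma^{<k>}(x)) : x\in U^{k+1}\}$. Theorem 4.1. Let $(s_n)_{n\in\mathbb N}$ and $(r_n)_{n\in\mathbb N}$ be sequences of positive reals such that $\sum_{n=1}^\infty s_n<\infty$ and $r_n\ge s_n+\frac{2}{n^2}$ for each $n\in\mathbb N$. Let $(\gamma_n)_{n\in\mathbb N}$ be a sequence of smooth maps $\gamma_n\colon[-r_n,r_n]\to E$ such that, for each gauge $q$ on $E$, there exists a calibration $(q_n)_{n\in\mathbb N_0}$ extending $q$ with $$\lim_{n\to\infty} n^\ell\,\|\gamma_n^{<k>}\|_{q_{n+m},\infty}=0\qquad\text{for all }k,\ell,m\in\mathbb N_0.$$ Then there exist a curve $\gamma\in BC^\infty(\mathbb R,E)$ with $\operatorname{im}(\gamma)\subseteq[0,1]\cdot\bigcup_{n\in\mathbb N}\operatorname{im}(\gamma_n)$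 and a convergent sequence $(t_n)_{n\in\mathbb N}$ of real numbers such that $$\gamma(t_n+t)=\gamma_n(t)\quad\text{for all }n\in\mathbb N\text{ and }t\in[-s_n,s_n].$$ -/

import Mathlib

open Set Filter Topology
open scoped ENNReal Pointwise

noncomputable section

namespace CurveLemma

variable {E : Type*} [AddCommGroup E] [Module ℝ E] [TopologicalSpace E]

/-- The power `U^k`, as a set of maps `Fin k → ℝ`. -/
def cube (U : Set ℝ) (k : ℕ) : Set (Fin k → ℝ) := {x | ∀ i, x i ∈ U}

/-- `F : U^{k+2} → E` is a continuous extension of the partial difference quotient of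
`G : U^{k+1} → E`, i.e. `F` is continuous on `U^{k+2}` and
`F(x_0,…,x_{k+1}) = (G(x_{k+1},x_1,…,x_k) - G(x_0,x_1,…,x_k)) / (x_{k+1} - x_0)`
whenever `x_0 ≠ x_{k+1}`. Values off `U^{k+2}` are irrelevant. -/
def IsQuotientMap (U : Set ℝ) {k : ℕ} (G : (Fin (k + 1) → ℝ) → E)
    (F : (Fin (k + 2) → ℝ) → E) : Prop :=
  ContinuousOn F (cube U (k + 2)) ∧
    ∀ x ∈ cube U (k + 2), x 0 ≠ x (Fin.last (k + 1)) →
      F x = (x (Fin.last (k + 1)) - x 0)⁻¹ •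
        (G (Function.update (Fin.init x) 0 (x (Fin.last (k + 1)))) - G (Fin.init x))

open Classical in
/-- The iterated difference quotient map `γ^{<k>} : U^{k+1} → E`: `γ^{<0>} = γ`, and
`γ^{<k+1>}` is the continuous extension of the partial difference quotient of `γ^{<k>}`
(the value is `0` if there is none). For `U` without isolated points and `E` Hausdorff it is
uniquely determined on `U^{k+1}`, see `IsQuotientMap.eqOn`. -/
def diffQuot (U : Set ℝ) (γ : ℝ → E) : (k : ℕ) → (Fin (k + 1) → ℝ) → E
  | 0 => fun x => γ (x 0)
  | k + 1 => if h : ∃ F, IsQuotientMap U (diffQuot U γ k) F then h.choose else 0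

/-- `γ` is a `C^k`-map on `U` (a nonempty set without isolated points). -/
def IsCk (U : Set ℝ) (γ : ℝ → E) : ℕ → Prop
  | 0 => ContinuousOn γ U
  | k + 1 => IsCk U γ k ∧ ∃ F, IsQuotientMap U (diffQuot U γ k) F

/-- `γ` is smooth on `U`: it is `C^k` for every `k`. -/
def IsSmooth (U : Set ℝ) (γ : ℝ → E) : Prop := ∀ k, IsCk U γ k

/-- `γ ∈ BC^∞(U,E)`: `γ` is smooth on `U` and each `γ^{<k>}` has bounded image. -/
def IsBCSmooth (U : Set ℝ) (γ : ℝ → E) : Prop :=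
  IsSmooth U γ ∧ ∀ k, Bornology.IsVonNBounded ℝ (diffQuot U γ k '' cube U (k + 1))

/-- A gauge on a real topological vector space. -/
structure IsGauge (q : E → ℝ) : Prop where
  nonneg : ∀ x, 0 ≤ q x
  smul : ∀ (t : ℝ) (x : E), q (t • x) = |t| * q x
  ball_mem_nhds : ∀ r : ℝ, 0 < r → {x | q x < r} ∈ 𝓝 (0 : E)

/-- A calibration: a sequence of gauges with the fake triangle inequality. -/
structure IsCalibration (Q : ℕ → E → ℝ) : Prop where
  gauge : ∀ n, IsGauge (Q n)
  add_le : ∀ n x y, Q n (x + y) ≤ Q (n + 1) x + Q (n + 1) y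

/-- The supremum `‖γ^{<k>}‖_{q,∞}` of `q ∘ γ^{<k>}` over `U^{k+1}`, in `[0,∞]`. -/
def diffQuotSup (q : E → ℝ) (U : Set ℝ) (γ : ℝ → E) (k : ℕ) : ℝ≥0∞ :=
  ⨆ x ∈ cube U (k + 1), ENNReal.ofReal (q (diffQuot U γ k x))

/-- On a set without isolated points, the continuous extension of the partial difference
quotient is unique. -/
theorem IsQuotientMap.eqOn [T2Space E] {U : Set ℝ} (hU : Preperfect U) {k : ℕ}
    {G : (Fin (k + 1) → ℝ) → E} {F F' : (Fin (k + 2) → ℝ) → E}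
    (h : IsQuotientMap U G F) (h' : IsQuotientMap U G F') :
    EqOn F F' (cube U (k + 2)) := by
  intro x hx
  by_cases hne : x 0 = x (Fin.last (k + 1))
  swap
  · rw [h.2 x hx hne, h'.2 x hx hne]
  set a := x (Fin.last (k + 1)) with ha
  have hne0 : (0 : Fin (k + 2)) ≠ Fin.last (k + 1) := (Fin.last_pos).ne
  have hacc : (𝓝[U \ {a}] a).NeBot := accPt_principal_iff_nhdsWithin.1 (hU a (hx _))
  let p : ℝ → (Fin (k + 2) → ℝ) := fun t => Function.update x (Fin.last (k + 1)) t
  have hpa : p a = x := Function.update_eq_self _ _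
  have hpU : ∀ t ∈ U, p t ∈ cube U (k + 2) := by
    intro t ht i
    by_cases hi : i = Fin.last (k + 1)
    · subst hi; simpa [p] using ht
    · simpa [p, hi] using hx i
  have hpc : Continuous p := continuous_const.update _ continuous_id
  have hp : Tendsto p (𝓝[U \ {a}] a) (𝓝[cube U (k + 2)] x) := by
    refine tendsto_nhdsWithin_iff.2 ⟨?_, ?_⟩
    · have := hpc.tendsto a
      rw [hpa] at this
      exact this.mono_left nhdsWithin_le_nhds
    · filter_upwards [self_mem_nhdsWithin] with t ht using hpU t ht.1
  have l1 : Tendsto (F ∘ p) (𝓝[U \ {a}] a) (𝓝 (F x)) := (h.1 x hx).tendsto.comp hp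
  have l2 : Tendsto (F' ∘ p) (𝓝[U \ {a}] a) (𝓝 (F' x)) := (h'.1 x hx).tendsto.comp hp
  refine tendsto_nhds_unique_of_eventuallyEq l1 l2 ?_
  filter_upwards [self_mem_nhdsWithin] with t ht
  have hq : p t 0 ≠ p t (Fin.last (k + 1)) := by
    simp only [p, Function.update_self, Function.update_of_ne hne0, hne]
    exact fun h => ht.2 h.symm
  simp only [Function.comp_apply]
  rw [h.2 _ (hpU t ht.1) hq, h'.2 _ (hpU t ht.1) hq]

end CurveLemma

end

/-! The curves are cut off smoothly near the ends of intervals of radius `s n + 2 / n²` and placed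
side by side on consecutive intervals of the line. The total length is finite, so the intervals
accumulate only at one point `T`, where the curve is set to zero. Each cut-off piece vanishes on a
margin of width `1 / n²` at both ends of its interval. The only real question is smoothness at `T`.

Everything is phrased with divided differences at pairwise distinct nodes. They agree there with the
iterated difference quotients, and such tuples are dense. Hence a map on the line is smooth as soon
as its divided differences have limits at all tuples (`isSmooth_univ_of_tendsto`). By the recursion
along two distinct nodes, constant tuples suffice (`exists_tendsto_divDiff`). Near a point other
than `T` the curve is zero or a single product of smooth maps, and the Leibniz rule applies.

At `T` the key is `exists_pow_mul_divDiff_le`, an induction on the order. Let `N` be the least index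
whose carrier contains a node. If all nodes lie in the `N`-th interval, only one piece is involved.
Otherwise some node lies outside it, at distance at least `1 / N²` from a node in the carrier. The
recursion along this pair costs a factor `N²` and one step in the calibration, both affordable
because lower-order differences decay faster than any power of `N`. Derivatives of the cutoffs also
cost only powers of `n`.

Local convexity is never needed: gauges of balanced sets detect neighbourhoods and boundedness, and
for each order only boundedly many uses of the fake triangle inequality occur. -/

noncomputable section

namespace CurveLemma

/-! ### Divided differences -/

section DivDiff

variable {E : Type*} [AddCommGroup E] [Module ℝ E] {ι κ : Type*} [DecidableEq ι] [DecidableEq κ]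

/-- The divided difference of `f` at the nodes `y i`, `i ∈ J`. -/
def divDiff (f : ℝ → E) (J : Finset ι) (y : ι → ℝ) : E :=
  ∑ i ∈ J, (∏ j ∈ J.erase i, (y i - y j)⁻¹) • f (y i)

theorem divDiff_map (f : ℝ → E) (e : κ ↪ ι) (J : Finset κ) (y : ι → ℝ) :
    divDiff f (J.map e) y = divDiff f J (y ∘ e) := by
  simp only [divDiff, Finset.sum_map, ← Finset.map_erase, Finset.prod_map, Function.comp_apply]

theorem divDiff_singleton (f : ℝ → E) (i : ι) (y : ι → ℝ) : divDiff f {i} y = f (y i) := by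
  simp [divDiff]

theorem divDiff_congr {f g : ℝ → E} {J : Finset ι} {y : ι → ℝ} (h : ∀ i ∈ J, f (y i) = g (y i)) :
    divDiff f J y = divDiff g J y :=
  Finset.sum_congr rfl fun i hi => by rw [h i hi]

theorem divDiff_eq_zero {f : ℝ → E} {J : Finset ι} {y : ι → ℝ} (h : ∀ i ∈ J, f (y i) = 0) :
    divDiff f J y = 0 :=
  Finset.sum_eq_zero fun i hi => by rw [h i hi, smul_zero]

theorem divDiff_add (f g : ℝ → E) (J : Finset ι) (y : ι → ℝ) :
    divDiff (fun t => f t + g t) J y = divDiff f J y + divDiff g J y := by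
  simp only [divDiff, smul_add, Finset.sum_add_distrib]

theorem divDiff_const_smul (c : ℝ) (f : ℝ → E) (J : Finset ι) (y : ι → ℝ) :
    divDiff (fun t => c • f t) J y = c • divDiff f J y := by
  simp only [divDiff, Finset.smul_sum, smul_comm c]

theorem divDiff_comp_affine (f : ℝ → E) {J : Finset ι} {k : ℕ} (hJ : J.card = k + 1) (y : ι → ℝ)
    {c : ℝ} (hc : c ≠ 0) (d : ℝ) :
    divDiff (fun t => f (c * t + d)) J y = c ^ k • divDiff f J (fun i => c * y i + d) := by
  simp only [divDiff, Finset.smul_sum, smul_smul]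
  refine Finset.sum_congr rfl fun i hi => ?_
  congr 1
  have hk : (J.erase i).card = k := by rw [Finset.card_erase_of_mem hi, hJ]; rfl
  rw [← hk, ← Finset.prod_const, ← Finset.prod_mul_distrib]
  refine Finset.prod_congr rfl fun j _ => ?_
  rw [show c * y i + d - (c * y j + d) = c * (y i - y j) by ring, mul_inv, ← mul_assoc,
    mul_inv_cancel₀ hc, one_mul]

theorem divDiff_comp_sub (f : ℝ → E) (J : Finset ι) (y : ι → ℝ) (d : ℝ) :
    divDiff (fun t => f (t - d)) J y = divDiff f J (fun i => y i - d) := by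
  simp only [divDiff, sub_sub_sub_cancel_right]

/-- Multiplying by `y p - y i` cancels one factor and kills the term `p = i`. Two different faces
thus become sums over the same `J` and can be subtracted termwise. -/
theorem divDiff_erase {f : ℝ → E} {J : Finset ι} {y : ι → ℝ} (hy : InjOn y J) {i : ι}
    (hi : i ∈ J) :
    divDiff f (J.erase i) y =
      ∑ p ∈ J, ((y p - y i) * ∏ j ∈ J.erase p, (y p - y j)⁻¹) • f (y p) := by
  rw [← Finset.add_sum_erase J _ hi, sub_self, zero_mul, zero_smul, zero_add, divDiff]
  refine Finset.sum_congr rfl fun p hp => ?_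
  obtain ⟨hpi, hpJ⟩ := Finset.mem_erase.1 hp
  have hne : y p - y i ≠ 0 := sub_ne_zero.2 fun h => hpi (hy hpJ hi h)
  have hmem : i ∈ J.erase p := Finset.mem_erase.2 ⟨hpi.symm, hi⟩
  rw [← Finset.mul_prod_erase _ _ hmem, ← mul_assoc, mul_inv_cancel₀ hne, one_mul,
    Finset.erase_right_comm]

/-- The recursion of divided differences, for an arbitrary pair of nodes. -/
theorem divDiff_eq_sub {f : ℝ → E} {J : Finset ι} {y : ι → ℝ} (hy : InjOn y J) {i j : ι}
    (hi : i ∈ J) (hj : j ∈ J) (hij : i ≠ j) :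
    divDiff f J y = (y j - y i)⁻¹ • (divDiff f (J.erase i) y - divDiff f (J.erase j) y) := by
  have hne : y j - y i ≠ 0 := sub_ne_zero.2 fun h => hij (hy hj hi h).symm
  rw [divDiff_erase hy hi, divDiff_erase hy hj, ← Finset.sum_sub_distrib, Finset.smul_sum, divDiff]
  refine Finset.sum_congr rfl fun p _ => ?_
  rw [← sub_smul, smul_smul, ← sub_mul, ← mul_assoc]
  rw [show y p - y i - (y p - y j) = y j - y i by ring, inv_mul_cancel₀ hne, one_mul]

theorem divDiff_const {J : Finset ι} {y : ι → ℝ} (hy : InjOn y J) (hJ : 2 ≤ J.card) (c : E) :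
    divDiff (fun _ => c) J y = 0 := by
  obtain ⟨n, hn⟩ := Nat.exists_eq_add_of_le' hJ
  clear hJ
  induction n generalizing J with
  | zero =>
    obtain ⟨a, b, hab, rfl⟩ := Finset.card_eq_two.1 hn
    rw [divDiff_eq_sub hy (i := a) (j := b) (by simp) (by simp) hab]
    have h1 : ({a, b} : Finset ι).erase a = {b} := by
      ext x; simp only [Finset.mem_erase, Finset.mem_insert, Finset.mem_singleton]; grind
    have h2 : ({a, b} : Finset ι).erase b = {a} := by
      ext x; simp only [Finset.mem_erase, Finset.mem_insert, Finset.mem_singleton]; grind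
    rw [h1, h2, divDiff_singleton, divDiff_singleton, sub_self, smul_zero]
  | succ n ih =>
    obtain ⟨a, ha, b, hb, hab⟩ := Finset.one_lt_card.1 (by omega : 1 < J.card)
    have key : ∀ x ∈ J, divDiff (fun _ => c) (J.erase x) y = 0 := fun x hx =>
      ih (hy.mono (by simp))
        (by rw [Finset.card_erase_of_mem hx, hn]; rfl)
    rw [divDiff_eq_sub hy ha hb hab, key a ha, key b hb, sub_self, smul_zero]

/-- A divided difference is a divided difference of the slope function at one of the nodes. -/
theorem divDiff_insert {f : ℝ → E} {J : Finset ι} {y : ι → ℝ} {i : ι} (hi : i ∉ J)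
    (hJ : J.Nonempty) (hy : InjOn y (insert i J : Finset ι)) :
    divDiff f (insert i J) y = divDiff (fun t => (t - y i)⁻¹ • (f t - f (y i))) J y := by
  have hc : 2 ≤ (insert i J).card := by
    rw [Finset.card_insert_of_notMem hi]; have := hJ.card_pos; omega
  -- Subtracting the constant `f (y i)` changes nothing and removes the term of node `i`; in every
  -- other term the factor belonging to `i` forms the slope.
  have h0 := divDiff_const hy hc (-f (y i))
  have h1 : divDiff f (insert i J) y = divDiff (fun t => f t + -f (y i)) (insert i J) y := by
    rw [divDiff_add, h0, add_zero]
  rw [h1, divDiff, Finset.sum_insert hi, add_neg_cancel, smul_zero, zero_add, divDiff]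
  refine Finset.sum_congr rfl fun p hp => ?_
  have hpi : p ≠ i := fun h => hi (h ▸ hp)
  rw [Finset.erase_insert_of_ne hpi.symm, Finset.prod_insert (by simp [hi]), smul_smul,
    mul_comm (y p - y i)⁻¹, sub_eq_add_neg (f (y p))]

end DivDiff

/-! ### The product rule for divided differences. -/

section Leibniz

variable {E : Type*} [AddCommGroup E] [Module ℝ E] {ι : Type*} [LinearOrder ι]

/-- The Leibniz rule for divided differences. -/
theorem divDiff_smul (f : ℝ → ℝ) (g : ℝ → E) (J : Finset ι) {y : ι → ℝ} (hy : InjOn y J) :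
    divDiff (fun t => f t • g t) J y =
      ∑ j ∈ J, divDiff f (J.filter (· ≤ j)) y • divDiff g (J.filter (j ≤ ·)) y := by
  -- The least index is split off; `f` varies because it is replaced by its slope function at that
  -- node.
  induction J using Finset.induction_on_min generalizing f with
  | empty => simp [divDiff]
  | insert i J hlt ih =>
    have hi : i ∉ J := fun h => lt_irrefl _ (hlt i h)
    have e1 : (insert i J).filter (· ≤ i) = {i} := by
      ext x; simp only [Finset.mem_filter, Finset.mem_insert, Finset.mem_singleton]
      constructor
      · rintro ⟨rfl | h, h'⟩
        · rfl
        · exact absurd h' (not_le.2 (hlt x h))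
      · rintro rfl; simp
    have e2 : (insert i J).filter (i ≤ ·) = insert i J := by
      refine Finset.filter_true_of_mem fun x hx => ?_
      rcases Finset.mem_insert.1 hx with rfl | h
      exacts [le_rfl, (hlt x h).le]
    rw [Finset.sum_insert hi, e1, e2, divDiff_singleton]
    rcases J.eq_empty_or_nonempty with rfl | hJ
    · simp [divDiff]
    have hyJ : InjOn y J := hy.mono (by simp)
    have hsplit : divDiff (fun t => (t - y i)⁻¹ • (f t • g t - f (y i) • g (y i))) J y =
        divDiff (fun t => ((t - y i)⁻¹ • (f t - f (y i))) • g t +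
          f (y i) • ((t - y i)⁻¹ • (g t - g (y i)))) J y := by
      refine divDiff_congr fun j _ => ?_
      simp only [smul_eq_mul, mul_smul, sub_smul, smul_sub, smul_comm (f (y i))]
      abel
    rw [divDiff_insert hi hJ hy, hsplit, divDiff_add, divDiff_const_smul,
      ← divDiff_insert hi hJ hy, ih _ hyJ, add_comm]
    congr 1
    refine Finset.sum_congr rfl fun j hj => ?_
    have hij := hlt j hj
    have e3 : (insert i J).filter (· ≤ j) = insert i (J.filter (· ≤ j)) := by
      rw [Finset.filter_insert, if_pos hij.le]
    have e4 : (insert i J).filter (j ≤ ·) = J.filter (j ≤ ·) := by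
      rw [Finset.filter_insert, if_neg (not_le.2 hij)]
    rw [e3, e4, ← divDiff_insert (by simp [hi]) ⟨j, by simp [hj]⟩]
    refine hy.mono ?_
    rw [← e3]
    exact Finset.coe_subset.2 (Finset.filter_subset _ _)

end Leibniz

/-! ### Divided differences and iterated difference quotients -/

section Link

variable {E : Type*} [AddCommGroup E] [Module ℝ E]

/-- The tuple `(x_{k+1}, x_1, …, x_k)` is a reordering of the nodes other than `x_0`, and divided
differences do not depend on the order. -/
theorem divDiff_update_init (f : ℝ → E) {k : ℕ} (x : Fin (k + 2) → ℝ) :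
    divDiff f Finset.univ (Function.update (Fin.init x) 0 (x (Fin.last (k + 1)))) =
      divDiff f (Finset.univ.erase 0) x := by
  have hinj : Function.Injective
      (Function.update (Fin.castSucc : Fin (k + 1) → Fin (k + 2)) 0 (Fin.last (k + 1))) := by
    intro i j h
    by_cases hi : i = 0 <;> by_cases hj : j = 0
    · rw [hi, hj]
    · subst hi
      rw [Function.update_self, Function.update_of_ne hj] at h
      exact absurd h.symm (Fin.castSucc_lt_last j).ne
    · subst hj
      rw [Function.update_self, Function.update_of_ne hi] at h
      exact absurd h (Fin.castSucc_lt_last i).ne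
    · rw [Function.update_of_ne hi, Function.update_of_ne hj] at h
      exact Fin.castSucc_injective _ h
  have hmap : Finset.univ.map ⟨_, hinj⟩ = Finset.univ.erase (0 : Fin (k + 2)) := by
    refine Finset.eq_of_subset_of_card_le (fun p hp => ?_) (by simp)
    obtain ⟨i, -, rfl⟩ := Finset.mem_map.1 hp
    refine Finset.mem_erase.2 ⟨?_, Finset.mem_univ _⟩
    by_cases hi : i = 0
    · subst hi; simp
    · simp [hi]
  rw [← hmap, divDiff_map, Function.Embedding.coeFn_mk, Function.comp_update]
  rfl

theorem divDiff_init (f : ℝ → E) {k : ℕ} (x : Fin (k + 2) → ℝ) :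
    divDiff f Finset.univ (Fin.init x) = divDiff f (Finset.univ.erase (Fin.last (k + 1))) x := by
  have hmap : Finset.univ.map Fin.castSuccEmb = Finset.univ.erase (Fin.last (k + 1)) := by
    refine Finset.eq_of_subset_of_card_le (fun p hp => ?_) (by simp)
    obtain ⟨i, -, rfl⟩ := Finset.mem_map.1 hp
    exact Finset.mem_erase.2 ⟨(Fin.castSucc_lt_last i).ne, Finset.mem_univ _⟩
  rw [← hmap, divDiff_map]
  rfl

theorem divDiff_succAbove (f : ℝ → E) {k : ℕ} (x : Fin (k + 2) → ℝ) (i : Fin (k + 2)) :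
    divDiff f Finset.univ (x ∘ i.succAbove) = divDiff f (Finset.univ.erase i) x := by
  have hmap : Finset.univ.map (Fin.succAboveEmb i) = Finset.univ.erase i := by
    refine Finset.eq_of_subset_of_card_le (fun p hp => ?_) (by simp)
    obtain ⟨j, -, rfl⟩ := Finset.mem_map.1 hp
    exact Finset.mem_erase.2 ⟨Fin.succAbove_ne i j, Finset.mem_univ _⟩
  rw [← hmap, divDiff_map]
  rfl

theorem divDiff_univ_eq_quotient (f : ℝ → E) {k : ℕ} {x : Fin (k + 2) → ℝ}
    (hx : Function.Injective x) :
    divDiff f Finset.univ x = (x (Fin.last (k + 1)) - x 0)⁻¹ •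
      (divDiff f Finset.univ (Function.update (Fin.init x) 0 (x (Fin.last (k + 1)))) -
        divDiff f Finset.univ (Fin.init x)) := by
  rw [divDiff_update_init, divDiff_init]
  exact divDiff_eq_sub hx.injOn (Finset.mem_univ _) (Finset.mem_univ _) (Fin.last_pos).ne

theorem injective_init {k : ℕ} {x : Fin (k + 2) → ℝ} (hx : Function.Injective x) :
    Function.Injective (Fin.init x : Fin (k + 1) → ℝ) :=
  hx.comp (Fin.castSucc_injective _)

theorem injective_update_init {k : ℕ} {x : Fin (k + 2) → ℝ} (hx : Function.Injective x) :
    Function.Injective (Function.update (Fin.init x : Fin (k + 1) → ℝ) 0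
      (x (Fin.last (k + 1)))) := by
  intro i j h
  have hl : ∀ i : Fin (k + 1), (Fin.init x : Fin (k + 1) → ℝ) i ≠ x (Fin.last (k + 1)) :=
    fun i h => (Fin.castSucc_lt_last i).ne (hx h)
  by_cases hi : i = 0 <;> by_cases hj : j = 0
  · rw [hi, hj]
  · subst hi
    rw [Function.update_self, Function.update_of_ne hj] at h
    exact absurd h.symm (hl j)
  · subst hj
    rw [Function.update_self, Function.update_of_ne hi] at h
    exact absurd h (hl i)
  · rw [Function.update_of_ne hi, Function.update_of_ne hj] at h
    exact injective_init hx h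

theorem dense_injective (n : ℕ) : Dense {x : Fin n → ℝ | Function.Injective x} := by
  intro x
  -- This perturbation separates equal coordinates for every `t > 0` and keeps distinct ones
  -- distinct for small `t`.
  let p : ℝ → Fin n → ℝ := fun t i => x i + t * (i : ℕ)
  have hp : Tendsto p (𝓝[>] 0) (𝓝 x) := by
    have hc : Continuous p := by fun_prop
    have h0 : p 0 = x := by ext i; simp [p]
    have := hc.tendsto 0
    rw [h0] at this
    exact this.mono_left nhdsWithin_le_nhds
  have hij : ∀ q : Fin n × Fin n, ∀ᶠ t in 𝓝[>] (0 : ℝ), p t q.1 = p t q.2 → q.1 = q.2 := by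
    rintro ⟨i, j⟩
    rcases eq_or_ne (x i) (x j) with h | h
    · filter_upwards [self_mem_nhdsWithin] with t ht h'
      have h2 : t * ((i : ℕ) : ℝ) = t * ((j : ℕ) : ℝ) := by
        simp only [p, h] at h'; linarith
      exact Fin.ext (Nat.cast_injective (mul_left_cancel₀ (ne_of_gt ht) h2))
    · have h1 := ((continuous_apply i).tendsto x).comp hp
      have h2 := ((continuous_apply j).tendsto x).comp hp
      filter_upwards [(h1.prodMk_nhds h2).eventually
        (isOpen_ne_fun continuous_fst continuous_snd |>.mem_nhds h)] with t ht h'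
      exact absurd h' ht
  refine mem_closure_of_tendsto hp ?_
  filter_upwards [eventually_all.2 hij] with t ht i j h using ht (i, j) h

variable [TopologicalSpace E]

theorem IsSmooth.isQuotientMap {U : Set ℝ} {f : ℝ → E} (hf : IsSmooth U f) (k : ℕ) :
    IsQuotientMap U (diffQuot U f k) (diffQuot U f (k + 1)) := by
  have h := (hf (k + 1)).2
  rw [diffQuot, dif_pos h]
  exact h.choose_spec

theorem IsSmooth.continuousOn_diffQuot {U : Set ℝ} {f : ℝ → E} (hf : IsSmooth U f) (k : ℕ) :
    ContinuousOn (diffQuot U f k) (cube U (k + 1)) := by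
  cases k with
  | zero =>
    have h : ContinuousOn f U := hf 0
    exact h.comp (continuous_apply 0).continuousOn fun x hx => hx 0
  | succ k => exact (hf.isQuotientMap k).1

theorem update_init_mem_cube {U : Set ℝ} {k : ℕ} {x : Fin (k + 2) → ℝ} (hx : x ∈ cube U (k + 2)) :
    Function.update (Fin.init x) 0 (x (Fin.last (k + 1))) ∈ cube U (k + 1) := by
  intro i
  by_cases hi : i = 0
  · subst hi; simpa using hx _
  · rw [Function.update_of_ne hi]; exact hx _

theorem IsSmooth.diffQuot_eq_divDiff {U : Set ℝ} {f : ℝ → E} (hf : IsSmooth U f) {k : ℕ}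
    {x : Fin (k + 1) → ℝ} (hx : x ∈ cube U (k + 1)) (hinj : Function.Injective x) :
    diffQuot U f k x = divDiff f Finset.univ x := by
  induction k with
  | zero => simp [divDiff, diffQuot]
  | succ k ih =>
    rw [(hf.isQuotientMap k).2 x hx (fun h => (Fin.last_pos).ne (hinj h)),
      ih (update_init_mem_cube hx) (injective_update_init hinj),
      ih (x := Fin.init x) (fun i => hx _) (injective_init hinj), ← divDiff_univ_eq_quotient f hinj]

variable [IsTopologicalAddGroup E] [ContinuousSMul ℝ E]

/-- Limits of divided differences need only be checked at constant tuples. -/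
theorem exists_tendsto_divDiff {f : ℝ → E}
    (h : ∀ (a : ℝ) (k : ℕ), ∃ e, Tendsto (divDiff f (Finset.univ : Finset (Fin (k + 1))))
      (𝓝[{y | Function.Injective y}] fun _ => a) (𝓝 e)) (k : ℕ) (x : Fin (k + 1) → ℝ) :
    ∃ e, Tendsto (divDiff f Finset.univ) (𝓝[{y | Function.Injective y}] x) (𝓝 e) := by
  by_cases hx : ∀ i, x i = x 0
  · have : x = fun _ => x 0 := funext hx
    rw [this]
    exact h _ _
  push Not at hx
  obtain ⟨i, hi⟩ := hx
  induction k with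
  | zero => exact absurd (congrArg x (Subsingleton.elim (α := Fin 1) i 0)) hi
  | succ k ih =>
    have ih' : ∀ z : Fin (k + 1) → ℝ,
        ∃ e, Tendsto (divDiff f Finset.univ) (𝓝[{y | Function.Injective y}] z) (𝓝 e) := by
      intro z
      by_cases hz : ∀ i, z i = z 0
      · have : z = fun _ => z 0 := funext hz
        rw [this]
        exact h _ _
      · push Not at hz
        obtain ⟨j, hj⟩ := hz
        exact ih z j hj
    have hface : ∀ p : Fin (k + 2), ∃ e, Tendsto (divDiff f (Finset.univ.erase p))
        (𝓝[{y | Function.Injective y}] x) (𝓝 e) := by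
      intro p
      obtain ⟨e, he⟩ := ih' (x ∘ p.succAbove)
      refine ⟨e, ?_⟩
      have hc : Continuous fun y : Fin (k + 2) → ℝ => y ∘ p.succAbove := by fun_prop
      have ht : Tendsto (fun y : Fin (k + 2) → ℝ => y ∘ p.succAbove)
          (𝓝[{y | Function.Injective y}] x) (𝓝[{y | Function.Injective y}] (x ∘ p.succAbove)) := by
        refine tendsto_nhdsWithin_iff.2 ⟨(hc.tendsto x).mono_left nhdsWithin_le_nhds, ?_⟩
        filter_upwards [self_mem_nhdsWithin] with y hy
        exact Function.Injective.comp hy Fin.succAbove_right_injective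
      exact (he.comp ht).congr fun y => divDiff_succAbove f y p
    obtain ⟨e₁, h₁⟩ := hface i
    obtain ⟨e₂, h₂⟩ := hface 0
    -- Along the pair `i`, `0` the denominators stay away from zero, so convergence of the two faces
    -- suffices.
    have hne : x 0 - x i ≠ 0 := sub_ne_zero.2 hi.symm
    have hq : Tendsto (fun y : Fin (k + 2) → ℝ => (y 0 - y i)⁻¹)
        (𝓝[{y | Function.Injective y}] x) (𝓝 (x 0 - x i)⁻¹) :=
      ((((continuous_apply 0).sub (continuous_apply i)).tendsto x).mono_left
        nhdsWithin_le_nhds).inv₀ hne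
    refine ⟨_, (hq.smul (h₁.sub h₂)).congr' ?_⟩
    filter_upwards [self_mem_nhdsWithin] with y hy
    exact (divDiff_eq_sub (Function.Injective.injOn hy) (Finset.mem_univ i) (Finset.mem_univ 0)
      fun h => hi (by rw [h])).symm

/-- A map on `ℝ` all of whose divided differences have limits along injective tuples is smooth,
and its iterated difference quotients are limits of divided differences. -/
theorem isSmooth_univ_of_tendsto [T2Space E] {f : ℝ → E}
    (h : ∀ (k : ℕ) (x : Fin (k + 1) → ℝ),
      ∃ e, Tendsto (divDiff f Finset.univ) (𝓝[{y | Function.Injective y}] x) (𝓝 e)) :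
    IsSmooth univ f ∧ ∀ k (x : Fin (k + 1) → ℝ), diffQuot univ f k x ∈
      closure (divDiff f (Finset.univ : Finset (Fin (k + 1))) '' {y | Function.Injective y}) := by
  let F : (k : ℕ) → (Fin (k + 1) → ℝ) → E := fun k =>
    extendFrom {y | Function.Injective y} (divDiff f Finset.univ)
  have hFc : ∀ k, Continuous (F k) := fun k => continuous_extendFrom (dense_injective _) (h k)
  have hF : ∀ k (x : Fin (k + 1) → ℝ), Function.Injective x → F k x = divDiff f Finset.univ x := by
    intro k x hx
    obtain ⟨e, he⟩ := h k x
    have hp : Tendsto (divDiff f Finset.univ) (pure x) (𝓝 e) :=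
      he.mono_left (pure_le_nhdsWithin hx)
    have hee : divDiff f Finset.univ x = e :=
      tendsto_nhds_unique (tendsto_pure_left.2 fun s hs => mem_of_mem_nhds hs) hp
    exact extendFrom_eq (dense_injective _ x) (hee ▸ he)
  -- Both sides are continuous where the end nodes differ and agree at injective tuples, which are
  -- dense.
  have hquot : ∀ k, IsQuotientMap univ (F k) (F (k + 1)) := by
    refine fun k => ⟨(hFc _).continuousOn, fun x _ hx => ?_⟩
    have hne : (𝓝[{y : Fin (k + 2) → ℝ | Function.Injective y}] x).NeBot :=
      mem_closure_iff_nhdsWithin_neBot.1 (dense_injective _ x)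
    have hinit : Continuous fun y : Fin (k + 2) → ℝ => (Fin.init y : Fin (k + 1) → ℝ) :=
      continuous_pi fun i => continuous_apply _
    have h1 : Tendsto (fun y : Fin (k + 2) → ℝ => (y (Fin.last (k + 1)) - y 0)⁻¹ •
        (F k (Function.update (Fin.init y) 0 (y (Fin.last (k + 1)))) - F k (Fin.init y)))
        (𝓝 x) (𝓝 ((x (Fin.last (k + 1)) - x 0)⁻¹ •
        (F k (Function.update (Fin.init x) 0 (x (Fin.last (k + 1)))) - F k (Fin.init x)))) := by
      refine Tendsto.smul ?_ (Tendsto.sub ?_ ?_)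
      · exact (((continuous_apply (Fin.last (k + 1))).sub (continuous_apply 0)).tendsto x).inv₀
          (sub_ne_zero.2 hx.symm)
      · exact ((hFc k).comp (hinit.update 0 (continuous_apply _))).tendsto x
      · exact ((hFc k).comp hinit).tendsto x
    refine tendsto_nhds_unique_of_eventuallyEq (l := 𝓝[{y | Function.Injective y}] x)
      (((hFc (k + 1)).tendsto x).mono_left nhdsWithin_le_nhds)
      (h1.mono_left nhdsWithin_le_nhds) ?_
    filter_upwards [self_mem_nhdsWithin] with y hy
    rw [hF _ _ hy, hF _ _ (injective_update_init hy), hF _ _ (injective_init hy)]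
    exact divDiff_univ_eq_quotient f hy
  have hcube : ∀ k, cube univ k = univ := fun k => eq_univ_of_forall fun x i => mem_univ _
  have hmain : ∀ k, IsCk univ f k ∧ diffQuot univ f k = F k := by
    intro k
    induction k with
    | zero =>
      have h0 : ∀ x : Fin 1 → ℝ, F 0 x = f (x 0) := fun x => by
        rw [hF 0 x (Function.injective_of_subsingleton x)]; simp [divDiff]
      refine ⟨?_, funext fun x => (h0 x).symm⟩
      have : f = F 0 ∘ fun t _ => t := funext fun t => (h0 fun _ => t).symm
      rw [this]
      exact ((hFc 0).comp (by fun_prop)).continuousOn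
    | succ k ih =>
      have hex : ∃ G, IsQuotientMap univ (diffQuot univ f k) G := ⟨F (k + 1), ih.2 ▸ hquot k⟩
      refine ⟨⟨ih.1, hex⟩, funext fun x => ?_⟩
      rw [diffQuot, dif_pos hex]
      exact hex.choose_spec.eqOn PerfectSpace.univ_preperfect (ih.2 ▸ hquot k)
        (by rw [hcube]; trivial)
  refine ⟨fun k => (hmain k).1, fun k x => ?_⟩
  have hne : (𝓝[{y : Fin (k + 1) → ℝ | Function.Injective y}] x).NeBot :=
    mem_closure_iff_nhdsWithin_neBot.1 (dense_injective _ x)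
  rw [(hmain k).2]
  refine mem_closure_of_tendsto (b := 𝓝[{y | Function.Injective y}] x)
    (((hFc k).tendsto x).mono_left nhdsWithin_le_nhds) ?_
  filter_upwards [self_mem_nhdsWithin] with y hy
  exact ⟨y, hy, (hF k y hy).symm⟩

end Link

/-! ### Divided differences of smooth real functions -/

section Real

variable {ι : Type*} [DecidableEq ι]

/-- The slope of `h` at `y i` is the mean of `deriv h` over the segment from `y i` to `t`; divided
differences commute with this integral. -/
theorem divDiff_insert_eq_integral {h : ℝ → ℝ} (hh : ContDiff ℝ (⊤ : ℕ∞) h) {J : Finset ι}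
    {y : ι → ℝ} {i : ι} (hi : i ∉ J) (hJ : J.Nonempty)
    (hy : InjOn y (insert i J : Finset ι)) :
    divDiff h (insert i J) y =
      ∫ s in (0 : ℝ)..1, divDiff (fun t => deriv h (s * t + (1 - s) * y i)) J y := by
  have hd : Continuous (deriv h) := (contDiff_infty_iff_deriv.1 hh).2.continuous
  rw [divDiff_insert hi hJ hy]
  simp only [divDiff]
  rw [intervalIntegral.integral_finsetSum]
  swap
  · intro p _
    exact Continuous.intervalIntegrable (by fun_prop) _ _
  refine Finset.sum_congr rfl fun p hp => ?_
  have hne : y p - y i ≠ 0 := by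
    refine sub_ne_zero.2 fun h => hi ?_
    rwa [← hy (Finset.mem_insert_of_mem hp) (Finset.mem_insert_self i J) h]
  rw [intervalIntegral.integral_smul]
  congr 1
  have hder : ∀ s ∈ uIcc (0 : ℝ) 1, HasDerivAt
      (fun s => (y p - y i)⁻¹ * h (s * y p + (1 - s) * y i))
      (deriv h (s * y p + (1 - s) * y i)) s := by
    intro s _
    have h1 : HasDerivAt (fun s : ℝ => s * y p + (1 - s) * y i) (y p - y i) s := by
      have := ((hasDerivAt_id s).mul_const (y p)).add
        (((hasDerivAt_const s (1 : ℝ)).sub (hasDerivAt_id s)).mul_const (y i))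
      convert! this using 1
      ring
    have h2 := ((contDiff_infty_iff_deriv.1 hh).1
      (s * y p + (1 - s) * y i)).hasDerivAt.comp s h1
    convert! h2.const_mul (y p - y i)⁻¹ using 1
    field_simp
  rw [intervalIntegral.integral_eq_sub_of_hasDerivAt hder
    (Continuous.intervalIntegrable (by fun_prop) _ _)]
  simp only [smul_eq_mul, one_mul, sub_self, zero_mul, add_zero, sub_zero, zero_add]
  ring

/-- A divided difference of order `k` averages the `k`-th derivative over a simplex of volume `1 /
k!` (Hermite–Genocchi). In the induction the affine substitution contributes `s ^ k`, whose integral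
`1 / (k + 1)` completes the factorial. -/
theorem abs_divDiff_sub_le {B : Set ℝ} (hB : Convex ℝ B) {k : ℕ} {h : ℝ → ℝ}
    (hh : ContDiff ℝ (⊤ : ℕ∞) h) {c ε : ℝ} (hc : ∀ t ∈ B, |iteratedDeriv k h t - c| ≤ ε)
    {J : Finset ι} (hJ : J.card = k + 1) {y : ι → ℝ} (hy : InjOn y J) (hyB : ∀ i ∈ J, y i ∈ B) :
    |divDiff h J y - c / k.factorial| ≤ ε := by
  induction k generalizing h J y with
  | zero =>
    obtain ⟨i, rfl⟩ := Finset.card_eq_one.1 hJ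
    simpa [divDiff_singleton] using hc _ (hyB i (by simp))
  | succ k ih =>
    obtain ⟨i, J, hi, rfl, hJ'⟩ := Finset.card_eq_succ.1 hJ
    have hne : J.Nonempty := Finset.card_pos.1 (by omega)
    have hyi : y i ∈ B := hyB i (by simp)
    have hε : 0 ≤ ε := (abs_nonneg _).trans (hc _ hyi)
    have hd : ContDiff ℝ (⊤ : ℕ∞) (deriv h) := (contDiff_infty_iff_deriv.1 hh).2
    have hdc := hd.continuous
    have hint : c / (k + 1).factorial = ∫ s in (0 : ℝ)..1, s ^ k * (c / k.factorial) := by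
      rw [intervalIntegral.integral_mul_const, integral_pow, Nat.factorial_succ]
      push_cast
      have := Nat.factorial_ne_zero k
      field_simp
      simp
    rw [divDiff_insert_eq_integral hh hi hne hy, hint, ← intervalIntegral.integral_sub
      (Continuous.intervalIntegrable (by unfold divDiff; fun_prop) _ _)
      (Continuous.intervalIntegrable (by fun_prop) _ _), ← Real.norm_eq_abs]
    refine (intervalIntegral.norm_integral_le_of_norm_le_const (C := ε) fun s hs => ?_).trans
      (by simp)
    rw [uIoc_of_le zero_le_one] at hs
    have hs0 : s ≠ 0 := hs.1.ne'
    rw [divDiff_comp_affine (deriv h) hJ' y hs0 ((1 - s) * y i), smul_eq_mul, ← mul_sub,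
      norm_mul, Real.norm_eq_abs, Real.norm_eq_abs]
    have hz : |divDiff (deriv h) J (fun p => s * y p + (1 - s) * y i) - c / k.factorial| ≤ ε := by
      refine ih hd (fun t ht => ?_) hJ' ?_ ?_
      · have := hc t ht
        rwa [iteratedDeriv_succ'] at this
      · intro p hp q hq hpq
        have : s * y p = s * y q := by simpa using hpq
        exact hy (Finset.mem_insert_of_mem hp) (Finset.mem_insert_of_mem hq)
          (mul_left_cancel₀ hs0 this)
      · intro p hp
        exact hB (hyB p (Finset.mem_insert_of_mem hp)) hyi hs.1.le (sub_nonneg.2 hs.2) (by ring)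
    calc _ ≤ 1 * ε := mul_le_mul
          (by rw [abs_pow, abs_of_pos hs.1]; exact pow_le_one₀ hs.1.le hs.2) hz
          (abs_nonneg _) zero_le_one
      _ = ε := one_mul ε

theorem tendsto_divDiff_real {h : ℝ → ℝ} (hh : ContDiff ℝ (⊤ : ℕ∞) h) (a : ℝ) (k : ℕ) :
    Tendsto (divDiff h (Finset.univ : Finset (Fin (k + 1))))
      (𝓝[{y | Function.Injective y}] fun _ => a) (𝓝 (iteratedDeriv k h a / k.factorial)) := by
  rw [Metric.tendsto_nhds]
  intro ε hε
  have hcont : Continuous (iteratedDeriv k h) := hh.continuous_iteratedDeriv k (by exact_mod_cast le_top)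
  obtain ⟨δ, hδ, hball⟩ := Metric.continuousAt_iff.1 hcont.continuousAt (ε / 2) (half_pos hε)
  have hev : ∀ᶠ y : Fin (k + 1) → ℝ in 𝓝 fun _ => a, ∀ i, y i ∈ Metric.ball a δ :=
    eventually_all.2 fun i => (continuous_apply i).tendsto _ (Metric.ball_mem_nhds a hδ)
  filter_upwards [nhdsWithin_le_nhds hev, self_mem_nhdsWithin] with y hy hinj
  refine lt_of_le_of_lt ?_ (half_lt_self hε)
  rw [Real.dist_eq]
  exact abs_divDiff_sub_le (convex_ball a δ) hh
    (fun t ht => by rw [← Real.dist_eq]; exact (hball ht).le) (by simp)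
    (Function.Injective.injOn hinj) fun i _ => hy i

theorem exists_abs_iteratedDeriv_smoothTransition_le (k : ℕ) :
    ∃ C, ∀ t, |iteratedDeriv k Real.smoothTransition t| ≤ C := by
  have hcont : Continuous (iteratedDeriv k Real.smoothTransition) :=
    (Real.smoothTransition.contDiff (n := ⊤)).continuous_iteratedDeriv k (by exact_mod_cast le_top)
  obtain ⟨C, hC⟩ := (isCompact_Icc (a := (0 : ℝ)) (b := 1)).exists_bound_of_continuousOn
    hcont.continuousOn
  -- Off `[0, 1]` the function is locally constant, so only the compact interval needs a bound.
  have hconst : ∀ c t : ℝ, |c| ≤ 1 → Real.smoothTransition =ᶠ[𝓝 t] (fun _ => c) →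
      |iteratedDeriv k Real.smoothTransition t| ≤ max C 1 := by
    intro c t hc ht
    rw [ht.iteratedDeriv_eq, iteratedDeriv_const]
    split_ifs
    · exact hc.trans (le_max_right _ _)
    · simp
  refine ⟨max C 1, fun t => ?_⟩
  rcases lt_or_ge t 0 with h0 | h0
  · refine hconst 0 t (by simp) ?_
    filter_upwards [Iio_mem_nhds h0] with u hu using Real.smoothTransition.zero_of_nonpos hu.le
  rcases lt_or_ge 1 t with h1 | h1
  · refine hconst 1 t (by simp) ?_
    filter_upwards [Ioi_mem_nhds h1] with u hu using Real.smoothTransition.one_of_one_le hu.le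
  · exact (hC t ⟨h0, h1⟩).trans (le_max_left _ _)

theorem exists_abs_divDiff_smoothTransition_le (ι : Type*) [DecidableEq ι] (k : ℕ) :
    ∃ C, 0 ≤ C ∧ ∀ (J : Finset ι) (y : ι → ℝ), J.Nonempty → J.card ≤ k + 1 → InjOn y J →
      |divDiff Real.smoothTransition J y| ≤ C := by
  choose C hC using exists_abs_iteratedDeriv_smoothTransition_le
  have hC0 : ∀ i, 0 ≤ C i := fun i => (abs_nonneg _).trans (hC i 0)
  refine ⟨∑ i ∈ Finset.range (k + 1), C i, Finset.sum_nonneg fun i _ => hC0 i,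
    fun J y hne hJ hy => ?_⟩
  obtain ⟨m, hm⟩ := Nat.exists_eq_succ_of_ne_zero hne.card_pos.ne'
  have h1 := abs_divDiff_sub_le convex_univ (Real.smoothTransition.contDiff (n := ⊤)) (c := 0)
    (fun t _ => by simpa using hC m t) hm hy (fun i _ => mem_univ _)
  rw [zero_div, sub_zero] at h1
  exact h1.trans (Finset.single_le_sum (f := C) (fun i _ => hC0 i)
    (Finset.mem_range.2 (by omega)))

end Real

/-! ### Limits of divided differences at constant tuples -/

section Converges

variable {E : Type*} [AddCommGroup E] [Module ℝ E] [TopologicalSpace E]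

/-- The divided differences of `f` of all orders converge along injective tuples at `(a,…,a)`. -/
def DivDiffConverges (f : ℝ → E) (a : ℝ) : Prop :=
  ∀ k : ℕ, ∃ e, Tendsto (divDiff f (Finset.univ : Finset (Fin (k + 1))))
    (𝓝[{y | Function.Injective y}] fun _ => a) (𝓝 e)

theorem DivDiffConverges.exists_tendsto {f : ℝ → E} {a : ℝ} (hf : DivDiffConverges f a) {n : ℕ}
    {I : Finset (Fin n)} (hI : I.Nonempty) :
    ∃ e, Tendsto (divDiff f I) (𝓝[{y | Function.Injective y}] fun _ => a) (𝓝 e) := by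
  obtain ⟨m, hm⟩ := Nat.exists_eq_succ_of_ne_zero hI.card_pos.ne'
  obtain ⟨e, he⟩ := hf m
  refine ⟨e, (he.comp (f := fun y : Fin n → ℝ => y ∘ I.orderEmbOfFin hm) ?_).congr fun y => ?_⟩
  · have hc : Continuous fun y : Fin n → ℝ => y ∘ I.orderEmbOfFin hm := by fun_prop
    refine tendsto_nhdsWithin_iff.2 ⟨(hc.tendsto _).mono_left nhdsWithin_le_nhds, ?_⟩
    filter_upwards [self_mem_nhdsWithin] with y hy
    exact Function.Injective.comp hy (I.orderEmbOfFin hm).injective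
  · have := divDiff_map f (I.orderEmbOfFin hm).toEmbedding Finset.univ y
    rw [Finset.map_orderEmbOfFin_univ] at this
    exact this.symm

theorem DivDiffConverges.congr {f g : ℝ → E} {a : ℝ} (hf : DivDiffConverges f a)
    (hfg : f =ᶠ[𝓝 a] g) : DivDiffConverges g a := by
  intro k
  obtain ⟨e, he⟩ := hf k
  refine ⟨e, he.congr' ?_⟩
  have hev : ∀ᶠ y : Fin (k + 1) → ℝ in 𝓝 fun _ => a, ∀ i, f (y i) = g (y i) :=
    eventually_all.2 fun i => ((continuous_apply i).tendsto fun _ => a).eventually hfg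
  filter_upwards [nhdsWithin_le_nhds hev] with y hy
  exact divDiff_congr fun i _ => hy i

theorem divDiffConverges_zero (a : ℝ) : DivDiffConverges (fun _ => (0 : E)) a :=
  fun _ => ⟨0, tendsto_const_nhds.congr fun _ => (divDiff_eq_zero fun _ _ => rfl).symm⟩

theorem IsSmooth.divDiffConverges {U : Set ℝ} {f : ℝ → E} (hf : IsSmooth U f) {a : ℝ}
    (ha : U ∈ 𝓝 a) : DivDiffConverges f a := by
  intro k
  have hU : cube U (k + 1) ∈ 𝓝 fun _ : Fin (k + 1) => a :=
    eventually_all.2 fun i => (continuous_apply i).tendsto _ ha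
  refine ⟨_, (((hf.continuousOn_diffQuot k).continuousAt hU).mono_left
    nhdsWithin_le_nhds).congr' ?_⟩
  filter_upwards [nhdsWithin_le_nhds hU, self_mem_nhdsWithin] with y hy hinj
  exact hf.diffQuot_eq_divDiff hy hinj

theorem divDiffConverges_of_contDiff {h : ℝ → ℝ} (hh : ContDiff ℝ (⊤ : ℕ∞) h) (a : ℝ) :
    DivDiffConverges h a :=
  fun k => ⟨_, tendsto_divDiff_real hh a k⟩

theorem DivDiffConverges.comp_sub {f : ℝ → E} {a d : ℝ} (hf : DivDiffConverges f (a - d)) :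
    DivDiffConverges (fun t => f (t - d)) a := by
  intro k
  obtain ⟨e, he⟩ := hf k
  refine ⟨e, (he.comp (f := fun (y : Fin (k + 1) → ℝ) i => y i - d) ?_).congr fun y => ?_⟩
  · have hc : Continuous fun (y : Fin (k + 1) → ℝ) i => y i - d := by fun_prop
    refine tendsto_nhdsWithin_iff.2 ⟨(hc.tendsto _).mono_left nhdsWithin_le_nhds, ?_⟩
    filter_upwards [self_mem_nhdsWithin] with y hy i j h
    exact hy (sub_left_injective h)
  · exact (divDiff_comp_sub f Finset.univ y d).symm

variable [IsTopologicalAddGroup E] [ContinuousSMul ℝ E]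

theorem DivDiffConverges.smul {f : ℝ → ℝ} {g : ℝ → E} {a : ℝ} (hf : DivDiffConverges f a)
    (hg : DivDiffConverges g a) : DivDiffConverges (fun t => f t • g t) a := by
  intro k
  have h1 : ∀ j : Fin (k + 1), ∃ e, Tendsto (divDiff f (Finset.univ.filter (· ≤ j)))
      (𝓝[{y | Function.Injective y}] fun _ => a) (𝓝 e) :=
    fun j => hf.exists_tendsto ⟨j, by simp⟩
  have h2 : ∀ j : Fin (k + 1), ∃ e, Tendsto (divDiff g (Finset.univ.filter (j ≤ ·)))
      (𝓝[{y | Function.Injective y}] fun _ => a) (𝓝 e) :=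
    fun j => hg.exists_tendsto ⟨j, by simp⟩
  choose e₁ h₁ using h1
  choose e₂ h₂ using h2
  refine ⟨_, (tendsto_finsetSum Finset.univ fun j _ => (h₁ j).smul (h₂ j)).congr' ?_⟩
  filter_upwards [self_mem_nhdsWithin] with y hy
  exact (divDiff_smul f g Finset.univ (Function.Injective.injOn hy)).symm

end Converges

/-! ### Gauges and calibrations -/

section Gauge

variable {E : Type*} [AddCommGroup E] [Module ℝ E] [TopologicalSpace E]

theorem IsGauge.map_zero {q : E → ℝ} (hq : IsGauge q) : q 0 = 0 := by
  simpa using hq.smul 0 0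

theorem IsGauge.map_neg {q : E → ℝ} (hq : IsGauge q) (x : E) : q (-x) = q x := by
  simpa using hq.smul (-1) x

/-- The Minkowski functional of a balanced neighbourhood is homogeneous without any convexity. -/
theorem exists_isGauge [ContinuousSMul ℝ E] {W : Set E} (hW : W ∈ 𝓝 (0 : E)) :
    ∃ q : E → ℝ, IsGauge q ∧ ∀ x, q x < 1 → x ∈ W := by
  have hbal : Balanced ℝ (balancedCore ℝ W) := balancedCore_balanced W
  have hnhds : balancedCore ℝ W ∈ 𝓝 (0 : E) := balancedCore_mem_nhds_zero hW
  refine ⟨gauge (balancedCore ℝ W), ⟨gauge_nonneg, fun t x => gauge_smul hbal t x,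
    fun r hr => ?_⟩, fun x hx => ?_⟩
  · filter_upwards [(set_smul_mem_nhds_zero_iff (half_pos hr).ne').2 hnhds] with x hx
    exact (gauge_le_of_mem (half_pos hr).le hx).trans_lt (half_lt_self hr)
  · obtain ⟨b, hb0, hb1, hxb⟩ := exists_lt_of_gauge_lt (absorbent_nhds_zero hnhds) hx
    obtain ⟨z, hz, rfl⟩ := hxb
    refine balancedCore_subset W (hbal b ?_ ⟨z, hz, rfl⟩)
    rw [Real.norm_eq_abs, abs_of_pos hb0]
    exact hb1.le

theorem IsGauge.exists_le_of_isVonNBounded {q : E → ℝ} (hq : IsGauge q) {S : Set E}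
    (hS : Bornology.IsVonNBounded ℝ S) : ∃ C, ∀ x ∈ S, q x ≤ C := by
  obtain ⟨r, hr⟩ := absorbs_iff_norm.1 (hS (hq.ball_mem_nhds 1 one_pos))
  refine ⟨|r|, fun x hx => ?_⟩
  obtain ⟨v, hv, rfl⟩ := hr |r| (by simpa using le_abs_self r) hx
  have hv' : q v < 1 := hv
  change q (|r| • v) ≤ |r|
  rw [hq.smul, abs_abs]
  exact mul_le_of_le_one_right (abs_nonneg r) hv'.le

theorem isVonNBounded_of_forall_isGauge [ContinuousSMul ℝ E] {S : Set E}
    (h : ∀ q : E → ℝ, IsGauge q → ∃ C, ∀ x ∈ S, q x ≤ C) : Bornology.IsVonNBounded ℝ S := by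
  intro W hW
  obtain ⟨q, hq, hqW⟩ := exists_isGauge hW
  obtain ⟨C, hC⟩ := h q hq
  refine absorbs_iff_norm.2 ⟨|C| + 1, fun c hc x hx => ?_⟩
  have hc0 : 0 < |c| := by
    have := abs_nonneg C
    rw [Real.norm_eq_abs] at hc
    linarith
  refine (mem_smul_set_iff_inv_smul_mem₀ (abs_pos.1 hc0) _ _).2 (hqW _ ?_)
  rw [hq.smul, abs_inv, inv_mul_lt_iff₀ hc0, mul_one]
  have := hC x hx
  have := le_abs_self C
  rw [Real.norm_eq_abs] at hc
  linarith

variable {Q : ℕ → E → ℝ}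

theorem IsCalibration.mono (hQ : IsCalibration Q) {m n : ℕ} (h : m ≤ n) (x : E) :
    Q m x ≤ Q n x := by
  refine monotone_nat_of_le_succ (f := fun n => Q n x) (fun n => ?_) h
  simpa [(hQ.gauge (n + 1)).map_zero] using hQ.add_le n x 0

theorem IsCalibration.sub_le (hQ : IsCalibration Q) (n : ℕ) (x y : E) :
    Q n (x - y) ≤ Q (n + 1) x + Q (n + 1) y := by
  simpa [sub_eq_add_neg, (hQ.gauge (n + 1)).map_neg] using hQ.add_le n x (-y)

/-- Each summand split off costs one index; monotonicity in the index makes the cost uniform. -/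
theorem IsCalibration.sum_le (hQ : IsCalibration Q) {ι : Type*} (J : Finset ι)
    (z : ι → E) (m : ℕ) : Q m (∑ j ∈ J, z j) ≤ ∑ j ∈ J, Q (m + J.card) (z j) := by
  classical
  induction J using Finset.induction_on generalizing m with
  | empty => simp [(hQ.gauge m).map_zero]
  | insert i J hi ih =>
    rw [Finset.sum_insert hi, Finset.sum_insert hi, Finset.card_insert_of_notMem hi]
    refine (hQ.add_le m _ _).trans (add_le_add (hQ.mono (by omega) _) ?_)
    rw [show m + (J.card + 1) = m + 1 + J.card by ring]
    exact ih (m + 1)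

end Gauge

/-! ### Estimates -/

section Cutoff

/-- A smooth function that is `1` on `[-s, s]` and vanishes where `s + 1 / c ≤ |t|`. -/
def cutoff (c s t : ℝ) : ℝ :=
  Real.smoothTransition (c * t + (c * s + 1)) * Real.smoothTransition (-c * t + (c * s + 1))

theorem cutoff_mem_Icc (c s t : ℝ) : cutoff c s t ∈ Icc (0 : ℝ) 1 :=
  ⟨mul_nonneg (Real.smoothTransition.nonneg _) (Real.smoothTransition.nonneg _),
    mul_le_one₀ (Real.smoothTransition.le_one _) (Real.smoothTransition.nonneg _)
      (Real.smoothTransition.le_one _)⟩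

theorem cutoff_eq_one {c s t : ℝ} (hc : 0 ≤ c) (ht : t ∈ Icc (-s) s) : cutoff c s t = 1 := by
  have h1 : 0 ≤ c * (t + s) := mul_nonneg hc (by linarith [ht.1])
  have h2 : 0 ≤ c * (s - t) := mul_nonneg hc (by linarith [ht.2])
  rw [cutoff, Real.smoothTransition.one_of_one_le (by linarith),
    Real.smoothTransition.one_of_one_le (by linarith), one_mul]

theorem cutoff_eq_zero {c s t : ℝ} (hc : 0 < c) (ht : s + 1 / c ≤ |t|) : cutoff c s t = 0 := by
  have h : c * s + 1 ≤ c * |t| := by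
    have := mul_le_mul_of_nonneg_left ht hc.le
    rwa [mul_add, mul_one_div_cancel hc.ne'] at this
  rcases abs_cases t with ⟨h', -⟩ | ⟨h', -⟩ <;> rw [h'] at h
  · rw [cutoff, Real.smoothTransition.zero_of_nonpos (x := -c * t + _) (by linarith), mul_zero]
  · rw [cutoff, Real.smoothTransition.zero_of_nonpos (x := c * t + _) (by linarith), zero_mul]

theorem contDiff_cutoff (c s : ℝ) : ContDiff ℝ (⊤ : ℕ∞) (cutoff c s) := by
  have h := Real.smoothTransition.contDiff (n := ⊤)
  exact (h.comp (by fun_prop : ContDiff ℝ _ fun t : ℝ => c * t + (c * s + 1))).mul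
    (h.comp (by fun_prop : ContDiff ℝ _ fun t : ℝ => -c * t + (c * s + 1)))

/-- Each of the two factors, rescaled by `±c`, contributes at most `c ^ k` in the Leibniz rule. With
`c = n²` the growth is polynomial in `n`, uniformly in `s`. -/
theorem exists_abs_divDiff_cutoff_le (ι : Type*) [LinearOrder ι] (k : ℕ) :
    ∃ M, 0 ≤ M ∧ ∀ c s : ℝ, 1 ≤ c → ∀ (J : Finset ι) (z : ι → ℝ), J.Nonempty →
      J.card ≤ k + 1 → InjOn z J → |divDiff (cutoff c s) J z| ≤ M * c ^ (2 * k) := by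
  obtain ⟨C, hC0, hC⟩ := exists_abs_divDiff_smoothTransition_le ι k
  have key : ∀ b c d : ℝ, 1 ≤ c → |b| = c → ∀ (J : Finset ι) (z : ι → ℝ), J.Nonempty →
      J.card ≤ k + 1 → InjOn z J →
      |divDiff (fun t => Real.smoothTransition (b * t + d)) J z| ≤ c ^ k * C := by
    intro b c d hc hb J z hJ hcard hz
    obtain ⟨m, hm⟩ := Nat.exists_eq_succ_of_ne_zero hJ.card_pos.ne'
    have hb0 : b ≠ 0 := abs_pos.1 (by rw [hb]; linarith)
    rw [divDiff_comp_affine _ hm z hb0 d, smul_eq_mul, abs_mul, abs_pow, hb]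
    refine mul_le_mul (pow_le_pow_right₀ hc (by omega)) (hC J _ hJ hcard fun p hp q hq h => ?_)
      (abs_nonneg _) (by positivity)
    exact hz hp hq (mul_left_cancel₀ hb0 (add_right_cancel h))
  refine ⟨(k + 1) * (C * C), by positivity, fun c s hc J z hJ hcard hz => ?_⟩
  have hsub : ∀ p : ι → Prop, [DecidablePred p] → InjOn z (J.filter p) := fun p _ =>
    hz.mono (Finset.coe_subset.2 (Finset.filter_subset _ _))
  have hle : ∀ p : ι → Prop, [DecidablePred p] → (J.filter p).card ≤ k + 1 := fun p _ =>
    (Finset.card_filter_le _ _).trans hcard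
  have hc0 : |c| = c := abs_of_nonneg (by linarith)
  have h := divDiff_smul (fun t => Real.smoothTransition (c * t + (c * s + 1)))
    (fun t => Real.smoothTransition (-c * t + (c * s + 1))) J hz
  simp only [smul_eq_mul] at h
  change |divDiff (fun t => Real.smoothTransition (c * t + (c * s + 1)) *
    Real.smoothTransition (-c * t + (c * s + 1))) J z| ≤ _
  rw [h]
  calc _ ≤ ∑ j ∈ J, (c ^ k * C) * (c ^ k * C) := by
        refine (Finset.abs_sum_le_sum_abs _ _).trans (Finset.sum_le_sum fun j hj => ?_)
        rw [abs_mul]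
        exact mul_le_mul (key c c _ hc hc0 _ _ ⟨j, by simp [hj]⟩ (hle _) (hsub _))
          (key (-c) c _ hc (by rw [abs_neg, hc0]) _ _ ⟨j, by simp [hj]⟩ (hle _) (hsub _))
          (abs_nonneg _) (by positivity)
    _ = J.card * (C * C * c ^ (2 * k)) := by
        rw [Finset.sum_const, nsmul_eq_mul]; ring
    _ ≤ (k + 1) * (C * C * c ^ (2 * k)) := by
        refine mul_le_mul_of_nonneg_right ?_ (by positivity)
        exact_mod_cast hcard
    _ = _ := by ring

end Cutoff

/-! ### Decay estimates for the pieces and for the assembled curve. -/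

section Estimates

variable {E : Type*} [AddCommGroup E] [Module ℝ E] [TopologicalSpace E]

theorem IsSmooth.exists_divDiff_eq {ι : Type*} [LinearOrder ι] {U : Set ℝ} {f : ℝ → E}
    (hf : IsSmooth U f) {k : ℕ} {J : Finset ι} (hJ : J.card = k + 1) {z : ι → ℝ}
    (hz : InjOn z J) (hzU : ∀ i ∈ J, z i ∈ U) :
    ∃ x ∈ cube U (k + 1), divDiff f J z = diffQuot U f k x := by
  have hmem : ∀ i, J.orderEmbOfFin hJ i ∈ J := J.orderEmbOfFin_mem hJ
  have hx : z ∘ J.orderEmbOfFin hJ ∈ cube U (k + 1) := fun i => hzU _ (hmem i)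
  refine ⟨_, hx, ?_⟩
  rw [hf.diffQuot_eq_divDiff hx fun i j h => (J.orderEmbOfFin hJ).injective
    (hz (hmem i) (hmem j) h)]
  have := divDiff_map f (J.orderEmbOfFin hJ).toEmbedding Finset.univ z
  rwa [Finset.map_orderEmbOfFin_univ] at this

/-- If the pieces of `f` on well-separated sets have rapidly decreasing divided differences, then
so has `f`. -/
theorem exists_pow_mul_divDiff_le {ι : Type*} [DecidableEq ι] {f : ℝ → E} {S I : ℕ → Set ℝ}
    {Q : ℕ → E → ℝ} (hQ : IsCalibration Q) (hzero : ∀ t, (∀ n, 1 ≤ n → t ∉ S n) → f t = 0)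
    (hsep : ∀ n : ℕ, 1 ≤ n → ∀ x ∈ S n, ∀ y ∉ I n, 1 / (n : ℝ) ^ 2 ≤ |y - x|)
    (hpiece : ∀ k l m : ℕ, ∃ C, 0 ≤ C ∧ ∀ n : ℕ, 1 ≤ n → ∀ (J : Finset ι) (y : ι → ℝ),
      J.card = k + 1 → InjOn y J → (∀ i ∈ J, y i ∈ I n) →
      (n : ℝ) ^ l * Q m (divDiff f J y) ≤ C) (k l m : ℕ) :
    ∃ C, 0 ≤ C ∧ ∀ n : ℕ, 1 ≤ n → ∀ (J : Finset ι) (y : ι → ℝ), J.card = k + 1 → InjOn y J →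
      (∀ i ∈ J, ∀ p, 1 ≤ p → p < n → y i ∉ S p) → (n : ℝ) ^ l * Q m (divDiff f J y) ≤ C := by
  classical
  -- Induction hypothesis one order lower: the exponent `l + 2` pays for the reciprocal gap, the
  -- index `m + 1` for one subtraction. It is vacuous for `k = 0`.
  have hface : ∃ C, 0 ≤ C ∧ ∀ n : ℕ, 1 ≤ n → ∀ (J : Finset ι) (y : ι → ℝ), J.card = k →
      1 ≤ k → InjOn y J → (∀ i ∈ J, ∀ p, 1 ≤ p → p < n → y i ∉ S p) →
      (n : ℝ) ^ (l + 2) * Q (m + 1) (divDiff f J y) ≤ C := by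
    cases k with
    | zero => exact ⟨0, le_rfl, fun _ _ _ _ _ h => absurd h (by norm_num)⟩
    | succ k =>
      obtain ⟨C, hC0, hC⟩ := exists_pow_mul_divDiff_le hQ hzero hsep hpiece k (l + 2) (m + 1)
      exact ⟨C, hC0, fun n hn J y hJ _ => hC n hn J y hJ⟩
  obtain ⟨A, hA0, hA⟩ := hpiece k l m
  obtain ⟨B, hB0, hB⟩ := hface
  refine ⟨A + (B + B), by positivity, fun n hn J y hJ hy hyS => ?_⟩
  by_cases hhit : ∃ p, 1 ≤ p ∧ ∃ i ∈ J, y i ∈ S p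
  swap
  · push Not at hhit
    rw [divDiff_eq_zero fun i hi => hzero _ fun p hp => hhit p hp i hi, (hQ.gauge m).map_zero,
      mul_zero]
    positivity
  -- Replacing `n` by the first index `N ≥ n` that is hit only strengthens the weight, and the faces
  -- still avoid all earlier sets.
  obtain ⟨⟨hN1, i, hi, hiS⟩, hmin⟩ :
      (1 ≤ Nat.find hhit ∧ ∃ i ∈ J, y i ∈ S (Nat.find hhit)) ∧
        ∀ p, 1 ≤ p → p < Nat.find hhit → ∀ i ∈ J, y i ∉ S p :=
    ⟨Nat.find_spec hhit, fun p hp hlt i hi h => Nat.find_min hhit hlt ⟨hp, i, hi, h⟩⟩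
  generalize Nat.find hhit = N at hN1 hiS hmin
  have hnN : n ≤ N := not_lt.1 fun h => hyS i hi N hN1 h hiS
  have hNpos : (0 : ℝ) < N := by exact_mod_cast hN1
  have hpow : (n : ℝ) ^ l * Q m (divDiff f J y) ≤ (N : ℝ) ^ l * Q m (divDiff f J y) :=
    mul_le_mul_of_nonneg_right (pow_le_pow_left₀ (Nat.cast_nonneg _) (by exact_mod_cast hnN) _)
      ((hQ.gauge m).nonneg _)
  refine hpow.trans ?_
  by_cases hall : ∀ j ∈ J, y j ∈ I N
  · exact (hA N hN1 J y hJ hy hall).trans (by linarith)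
  push Not at hall
  obtain ⟨j, hj, hjI⟩ := hall
  have hgap := hsep N hN1 _ hiS _ hjI
  have hij : i ≠ j := by
    rintro rfl
    rw [sub_self, abs_zero] at hgap
    exact absurd hgap (not_le.2 (by positivity))
  have hk : 1 ≤ k := by
    have := Finset.one_lt_card.2 ⟨i, hi, j, hj, hij⟩
    omega
  have hB' : ∀ p ∈ J, (N : ℝ) ^ (l + 2) * Q (m + 1) (divDiff f (J.erase p) y) ≤ B := fun p hp =>
    hB N hN1 (J.erase p) y (by rw [Finset.card_erase_of_mem hp, hJ]; rfl) hk
      (hy.mono (by simp)) fun q hq t ht htN => hmin t ht htN q (Finset.mem_of_mem_erase hq)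
  have hinv : |(y j - y i)⁻¹| ≤ (N : ℝ) ^ 2 := by
    rw [abs_inv, ← inv_inv ((N : ℝ) ^ 2), ← one_div ((N : ℝ) ^ 2)]
    exact inv_anti₀ (by positivity) hgap
  rw [divDiff_eq_sub hy hi hj hij, (hQ.gauge m).smul]
  calc _ ≤ (N : ℝ) ^ l * ((N : ℝ) ^ 2 * (Q (m + 1) (divDiff f (J.erase i) y) +
        Q (m + 1) (divDiff f (J.erase j) y))) := by
        have := hQ.sub_le m (divDiff f (J.erase i) y) (divDiff f (J.erase j) y)
        have := (hQ.gauge m).nonneg (divDiff f (J.erase i) y - divDiff f (J.erase j) y)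
        gcongr
    _ = (N : ℝ) ^ (l + 2) * Q (m + 1) (divDiff f (J.erase i) y) +
        (N : ℝ) ^ (l + 2) * Q (m + 1) (divDiff f (J.erase j) y) := by
        rw [pow_add]; ring
    _ ≤ A + (B + B) := by linarith [hB' i hi, hB' j hj]

variable [IsTopologicalAddGroup E] [ContinuousSMul ℝ E]

/-- For large `n` the limit applies because `Q m ≤ Q (n + m)`; the finitely many others are bounded
by compactness of the cubes. -/
theorem exists_pow_mul_diffQuot_le {γs : ℕ → ℝ → E} {r : ℕ → ℝ} {Q : ℕ → E → ℝ}
    (hQ : IsCalibration Q) (hsmooth : ∀ n, 1 ≤ n → IsSmooth (Icc (-r n) (r n)) (γs n))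
    {k l m : ℕ} (hlim : Tendsto (fun n : ℕ => (n : ℝ≥0∞) ^ l *
      diffQuotSup (Q (n + m)) (Icc (-r n) (r n)) (γs n) k) atTop (𝓝 0)) :
    ∃ C, 0 ≤ C ∧ ∀ n : ℕ, 1 ≤ n → ∀ x ∈ cube (Icc (-r n) (r n)) (k + 1),
      (n : ℝ) ^ l * Q m (diffQuot (Icc (-r n) (r n)) (γs n) k x) ≤ C := by
  obtain ⟨N, hN⟩ := eventually_atTop.1 (hlim.eventually (Iio_mem_nhds zero_lt_one))
  have hcpt : ∀ n, ∃ C, 1 ≤ n → ∀ x ∈ cube (Icc (-r n) (r n)) (k + 1),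
      Q m (diffQuot (Icc (-r n) (r n)) (γs n) k x) ≤ C := by
    intro n
    by_cases hn : 1 ≤ n
    swap
    · exact ⟨0, fun h => absurd h hn⟩
    have hc : IsCompact (cube (Icc (-r n) (r n)) (k + 1)) := by
      have : cube (Icc (-r n) (r n)) (k + 1) = univ.pi fun _ => Icc (-r n) (r n) := by
        ext x; simp only [cube, mem_ofPred_eq, mem_univ_pi]
      rw [this]
      exact isCompact_univ_pi fun _ => isCompact_Icc
    obtain ⟨C, hC⟩ := (hQ.gauge m).exists_le_of_isVonNBounded
      ((hc.image_of_continuousOn ((hsmooth n hn).continuousOn_diffQuot k)).isVonNBounded ℝ)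
    exact ⟨C, fun _ x hx => hC _ ⟨x, hx, rfl⟩⟩
  choose C hC using hcpt
  have hpos : ∀ n ∈ Finset.range N, 0 ≤ (n : ℝ) ^ l * |C n| := fun n _ => by positivity
  refine ⟨1 + ∑ n ∈ Finset.range N, (n : ℝ) ^ l * |C n|,
    add_nonneg zero_le_one (Finset.sum_nonneg hpos), fun n hn x hx => ?_⟩
  rcases lt_or_ge n N with h | h
  · have h1 := Finset.single_le_sum hpos (Finset.mem_range.2 h)
    have h2 : (n : ℝ) ^ l * Q m (diffQuot (Icc (-r n) (r n)) (γs n) k x) ≤ (n : ℝ) ^ l * |C n| :=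
      mul_le_mul_of_nonneg_left ((hC n hn x hx).trans (le_abs_self _)) (by positivity)
    linarith
  · have h1 : (n : ℝ≥0∞) ^ l * ENNReal.ofReal
        (Q (n + m) (diffQuot (Icc (-r n) (r n)) (γs n) k x)) ≤ 1 :=
      (mul_le_mul_right (le_iSup₂ (f := fun x (_ : x ∈ cube (Icc (-r n) (r n)) (k + 1)) =>
        ENNReal.ofReal (Q (n + m) (diffQuot (Icc (-r n) (r n)) (γs n) k x))) x hx) _).trans
        (hN n h).le
    rw [← ENNReal.ofReal_natCast, ← ENNReal.ofReal_pow (Nat.cast_nonneg n),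
      ← ENNReal.ofReal_mul (by positivity), ENNReal.ofReal_le_one] at h1
    have h2 := mul_le_mul_of_nonneg_left (hQ.mono (Nat.le_add_left m n)
      (diffQuot (Icc (-r n) (r n)) (γs n) k x)) (by positivity : (0 : ℝ) ≤ (n : ℝ) ^ l)
    exact (h2.trans h1).trans (le_add_of_nonneg_right (Finset.sum_nonneg hpos))

theorem exists_pow_mul_divDiff_cutoff_smul_le (ι : Type*) [LinearOrder ι] {γs : ℕ → ℝ → E}
    {r : ℕ → ℝ} {Q : ℕ → E → ℝ}
    (hQ : IsCalibration Q) (hsmooth : ∀ n, 1 ≤ n → IsSmooth (Icc (-r n) (r n)) (γs n))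
    (hlim : ∀ k l m, Tendsto (fun n : ℕ => (n : ℝ≥0∞) ^ l *
      diffQuotSup (Q (n + m)) (Icc (-r n) (r n)) (γs n) k) atTop (𝓝 0)) (s : ℕ → ℝ) (k l m : ℕ) :
    ∃ C, 0 ≤ C ∧ ∀ n : ℕ, 1 ≤ n → ∀ (J : Finset ι) (z : ι → ℝ), J.card = k + 1 → InjOn z J →
      (∀ i ∈ J, z i ∈ Icc (-r n) (r n)) →
      (n : ℝ) ^ l * Q m (divDiff (fun t => cutoff ((n : ℝ) ^ 2) (s n) t • γs n t) J z) ≤ C := by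
  obtain ⟨M, hM0, hM⟩ := exists_abs_divDiff_cutoff_le ι k
  -- The cutoff costs `(n²) ^ (2 * k) = n ^ (4 * k)`, and the Leibniz sum of `k + 1` terms costs `k
  -- + 1` indices.
  choose C hC0 hC using fun i =>
    exists_pow_mul_diffQuot_le hQ hsmooth (hlim i (l + 4 * k) (m + (k + 1)))
  refine ⟨(k + 1) * (M * ∑ i ∈ Finset.range (k + 1), C i), mul_nonneg (by positivity)
    (mul_nonneg hM0 (Finset.sum_nonneg fun i _ => hC0 i)), fun n hn J z hJ hz hzr => ?_⟩
  have hn1 : (1 : ℝ) ≤ (n : ℝ) ^ 2 := one_le_pow₀ (by exact_mod_cast hn)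
  have hsub : ∀ p : ι → Prop, [DecidablePred p] → InjOn z (J.filter p) := fun p _ =>
    hz.mono (Finset.coe_subset.2 (Finset.filter_subset _ _))
  rw [divDiff_smul _ _ J hz]
  have hterm : ∀ j ∈ J, (n : ℝ) ^ l * Q (m + (k + 1))
      (divDiff (cutoff ((n : ℝ) ^ 2) (s n)) (J.filter (· ≤ j)) z •
        divDiff (γs n) (J.filter (j ≤ ·)) z) ≤ M * ∑ i ∈ Finset.range (k + 1), C i := by
    intro j hj
    have hle : ∀ p : ι → Prop, [DecidablePred p] → (J.filter p).card ≤ k + 1 := fun p _ =>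
      hJ ▸ Finset.card_filter_le _ _
    have hne : (J.filter (j ≤ ·)).Nonempty := ⟨j, by simp [hj]⟩
    obtain ⟨i, hi⟩ := Nat.exists_eq_succ_of_ne_zero hne.card_pos.ne'
    have hik : i ∈ Finset.range (k + 1) := by
      have := hle (j ≤ ·)
      rw [Finset.mem_range]; omega
    obtain ⟨x, hx, hxe⟩ := (hsmooth n hn).exists_divDiff_eq hi (hsub _)
      fun p hp => hzr p (Finset.mem_filter.1 hp).1
    have h1 := hM ((n : ℝ) ^ 2) (s n) hn1 (J.filter (· ≤ j)) z ⟨j, by simp [hj]⟩ (hle _) (hsub _)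
    have h2 := (hC i n hn x hx).trans
      (Finset.single_le_sum (f := C) (fun i _ => hC0 i) hik)
    have hq := (hQ.gauge (m + (k + 1))).nonneg (diffQuot (Icc (-r n) (r n)) (γs n) i x)
    rw [(hQ.gauge _).smul, hxe]
    calc _ ≤ (n : ℝ) ^ l * ((M * ((n : ℝ) ^ 2) ^ (2 * k)) * Q (m + (k + 1))
          (diffQuot (Icc (-r n) (r n)) (γs n) i x)) := by gcongr
      _ = M * ((n : ℝ) ^ (l + 4 * k) * Q (m + (k + 1))
          (diffQuot (Icc (-r n) (r n)) (γs n) i x)) := by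
          rw [← pow_mul, pow_add]; ring_nf
      _ ≤ _ := by gcongr
  calc _ ≤ (n : ℝ) ^ l * ∑ j ∈ J, Q (m + (k + 1))
        (divDiff (cutoff ((n : ℝ) ^ 2) (s n)) (J.filter (· ≤ j)) z •
          divDiff (γs n) (J.filter (j ≤ ·)) z) := by
        rw [← hJ]
        exact mul_le_mul_of_nonneg_left (hQ.sum_le J _ m) (by positivity)
    _ ≤ ∑ j ∈ J, M * ∑ i ∈ Finset.range (k + 1), C i := by
        rw [Finset.mul_sum]
        exact Finset.sum_le_sum hterm
    _ = _ := by rw [Finset.sum_const, hJ, nsmul_eq_mul]; push_cast; rfl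

end Estimates

/-! ### The curve -/

section Curve

/-- The radius `s n + 2 / n²` of the `n`-th parameter interval. -/
def radius (s : ℕ → ℝ) (n : ℕ) : ℝ := s n + 2 / (n : ℝ) ^ 2

/-- The left end point of the `n`-th parameter interval. -/
def leftEnd (s : ℕ → ℝ) (n : ℕ) : ℝ := ∑ i ∈ Finset.range n, 2 * radius s i

/-- The centre of the `n`-th parameter interval. -/
def centre (s : ℕ → ℝ) (n : ℕ) : ℝ := leftEnd s n + radius s n

/-- An open interval in the `n`-th parameter interval outside of which the `n`-th piece of the
curve vanishes. -/
def carrier (s : ℕ → ℝ) (n : ℕ) : Set ℝ := {x | |x - centre s n| < s n + 1 / (n : ℝ) ^ 2}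

variable {s : ℕ → ℝ}

theorem leftEnd_succ (s : ℕ → ℝ) (n : ℕ) : leftEnd s (n + 1) = leftEnd s n + 2 * radius s n :=
  Finset.sum_range_succ _ _

theorem summable_radius (hsum : Summable s) : Summable (radius s) := by
  refine hsum.add ?_
  simpa [div_eq_mul_inv] using (Real.summable_nat_pow_inv.2 one_lt_two).mul_left 2

theorem tendsto_leftEnd (hsum : Summable s) :
    Tendsto (leftEnd s) atTop (𝓝 (∑' i, 2 * radius s i)) :=
  ((summable_radius hsum).mul_left 2).hasSum.tendsto_sum_nat

theorem tendsto_centre (hsum : Summable s) :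
    Tendsto (centre s) atTop (𝓝 (∑' i, 2 * radius s i)) := by
  have h := (tendsto_leftEnd hsum).add (summable_radius hsum).tendsto_atTop_zero
  rwa [add_zero] at h

theorem radius_pos (hs : ∀ n, 1 ≤ n → 0 < s n) {n : ℕ} (hn : 1 ≤ n) : 0 < radius s n :=
  add_pos_of_pos_of_nonneg (hs n hn) (by positivity)

/-- The restriction to `m ≥ 1` matters: the summand of index `0` is `2 * s 0`, of arbitrary sign,
and merely translates the whole configuration. -/
theorem leftEnd_mono (hs : ∀ n, 1 ≤ n → 0 < s n) {m n : ℕ} (hm : 1 ≤ m) (hmn : m ≤ n) :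
    leftEnd s m ≤ leftEnd s n := by
  induction n, hmn using Nat.le_induction with
  | base => exact le_rfl
  | succ n hmn ih =>
    rw [leftEnd_succ]
    linarith [radius_pos hs (hm.trans hmn)]

theorem leftEnd_lt_tsum (hs : ∀ n, 1 ≤ n → 0 < s n) (hsum : Summable s) {n : ℕ} (hn : 1 ≤ n) :
    leftEnd s n < ∑' i, 2 * radius s i := by
  have h1 : leftEnd s (n + 1) ≤ ∑' i, 2 * radius s i :=
    ge_of_tendsto (tendsto_leftEnd hsum)
      (eventually_atTop.2 ⟨n + 1, fun m hm => leftEnd_mono hs (by omega) hm⟩)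
  rw [leftEnd_succ] at h1
  linarith [radius_pos hs hn]

theorem mem_carrier_iff {n : ℕ} {x : ℝ} : x ∈ carrier s n ↔
    leftEnd s n + 1 / (n : ℝ) ^ 2 < x ∧ x < leftEnd s (n + 1) - 1 / (n : ℝ) ^ 2 := by
  have h2 : radius s n = s n + 2 * (1 / (n : ℝ) ^ 2) := by rw [radius, mul_one_div]
  rw [leftEnd_succ, carrier, mem_ofPred_eq, abs_lt, centre, h2]
  constructor <;> rintro ⟨h, h'⟩ <;> constructor <;> linarith

theorem lt_leftEnd_of_mem_carrier {n : ℕ} {x : ℝ} (hx : x ∈ carrier s n) :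
    x < leftEnd s (n + 1) := by
  have : (0 : ℝ) ≤ 1 / (n : ℝ) ^ 2 := by positivity
  linarith [(mem_carrier_iff.1 hx).2]

theorem leftEnd_lt_of_mem_carrier {n : ℕ} {x : ℝ} (hx : x ∈ carrier s n) : leftEnd s n < x := by
  have : (0 : ℝ) ≤ 1 / (n : ℝ) ^ 2 := by positivity
  linarith [(mem_carrier_iff.1 hx).1]

theorem eq_of_mem_carrier (hs : ∀ n, 1 ≤ n → 0 < s n) {m n : ℕ} (hm : 1 ≤ m) (hn : 1 ≤ n) {x : ℝ}
    (hx : x ∈ carrier s m) (hx' : x ∈ Icc (leftEnd s n) (leftEnd s (n + 1))) : m = n := by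
  rcases lt_trichotomy m n with h | h | h
  · have := leftEnd_mono hs (by omega : 1 ≤ m + 1) h
    linarith [lt_leftEnd_of_mem_carrier hx, hx'.1]
  · exact h
  · have := leftEnd_mono hs (by omega : 1 ≤ n + 1) h
    linarith [leftEnd_lt_of_mem_carrier hx, hx'.2]

theorem le_abs_sub_of_mem_carrier {n : ℕ} {x y : ℝ} (hx : x ∈ carrier s n)
    (hy : y ∉ Icc (leftEnd s n) (leftEnd s (n + 1))) : 1 / (n : ℝ) ^ 2 ≤ |y - x| := by
  obtain ⟨h1, h2⟩ := mem_carrier_iff.1 hx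
  rw [mem_Icc, not_and_or, not_le, not_le] at hy
  rcases hy with h | h
  · rw [abs_sub_comm]
    exact le_trans (by linarith) (le_abs_self _)
  · exact le_trans (by linarith) (le_abs_self _)

/-- A point that is neither interior to a parameter interval nor the limit of the parameter
intervals has a neighbourhood that meets no carrier. -/
theorem eventually_notMem_carrier (hs : ∀ n, 1 ≤ n → 0 < s n) (hsum : Summable s) {a : ℝ}
    (ha : a ≠ ∑' i, 2 * radius s i)
    (hint : ∀ n, 1 ≤ n → a ∉ Ioo (leftEnd s n) (leftEnd s (n + 1))) :
    ∀ᶠ x in 𝓝 a, ∀ n, 1 ≤ n → x ∉ carrier s n := by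
  have hT := tendsto_leftEnd hsum
  rcases lt_or_gt_of_ne ha with h | h
  swap
  · filter_upwards [Ioi_mem_nhds h] with x hx n hn hxn
    exact lt_asymm (lt_leftEnd_of_mem_carrier hxn)
      ((leftEnd_lt_tsum hs hsum (by omega : 1 ≤ n + 1)).trans hx)
  rcases lt_or_ge a (leftEnd s 1) with h1 | h1
  · filter_upwards [Iio_mem_nhds h1] with x hx n hn hxn
    exact lt_asymm (leftEnd_lt_of_mem_carrier hxn)
      (lt_of_lt_of_le hx (leftEnd_mono hs le_rfl hn))
  classical
  have hex : ∃ n, 1 ≤ n ∧ a < leftEnd s (n + 1) := by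
    obtain ⟨N, hN⟩ := eventually_atTop.1 (hT.eventually (Ioi_mem_nhds h))
    exact ⟨N + 1, by omega, hN _ (by omega)⟩
  obtain ⟨⟨hn1, hn2⟩, hmin⟩ : (1 ≤ Nat.find hex ∧ a < leftEnd s (Nat.find hex + 1)) ∧
      ∀ p, 1 ≤ p → p < Nat.find hex → leftEnd s (p + 1) ≤ a :=
    ⟨Nat.find_spec hex, fun p hp hlt => not_lt.1 fun h => Nat.find_min hex hlt ⟨hp, h⟩⟩
  generalize Nat.find hex = n at hn1 hn2 hmin
  have hle : leftEnd s n ≤ a := by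
    rcases hn1.eq_or_lt with rfl | h'
    · exact h1
    · have := hmin (n - 1) (by omega) (by omega)
      rwa [Nat.sub_add_cancel hn1] at this
  obtain rfl : a = leftEnd s n := by
    by_contra hne
    exact hint n hn1 ⟨lt_of_le_of_ne hle (Ne.symm hne), hn2⟩
  -- At the common end point of two intervals the radius `1 / n²` works: earlier margins are at
  -- least as wide, the `n`-th carrier has its own margin, and later intervals start at distance at
  -- least `2 / n²`.
  have hpos : (0 : ℝ) < 1 / (n : ℝ) ^ 2 := by
    have : (0 : ℝ) < n := by exact_mod_cast hn1
    positivity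
  filter_upwards [Ioo_mem_nhds (sub_lt_self _ hpos) (lt_add_of_pos_right _ hpos)] with x hx m hm hxm
  rcases lt_trichotomy m n with hmn | rfl | hmn
  · have h2 := leftEnd_mono hs (by omega : 1 ≤ m + 1) hmn
    have h3 : 1 / (n : ℝ) ^ 2 ≤ 1 / (m : ℝ) ^ 2 := by
      have : (0 : ℝ) < m := by exact_mod_cast hm
      have : (m : ℝ) ≤ n := by exact_mod_cast hmn.le
      gcongr
    linarith [(mem_carrier_iff.1 hxm).2, hx.1]
  · linarith [(mem_carrier_iff.1 hxm).1, hx.2]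
  · have h2 := leftEnd_mono hs (by omega : 1 ≤ n + 1) hmn
    have h3 : 1 / (n : ℝ) ^ 2 ≤ radius s n := by
      rw [radius, ← mul_one_div (2 : ℝ)]
      linarith [hs n hn1]
    rw [leftEnd_succ] at h2
    linarith [leftEnd_lt_of_mem_carrier hxm, hx.2]

variable {E : Type*} [AddCommGroup E] [Module ℝ E]

/-- The `n`-th piece of the curve. -/
def piece (s : ℕ → ℝ) (γs : ℕ → ℝ → E) (n : ℕ) (x : ℝ) : E :=
  cutoff ((n : ℝ) ^ 2) (s n) (x - centre s n) • γs n (x - centre s n)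

open Classical in
/-- The curve that runs through cut-off copies of the curves `γs n`, `1 ≤ n`. -/
def curve (s : ℕ → ℝ) (γs : ℕ → ℝ → E) (x : ℝ) : E :=
  if h : ∃ n, 1 ≤ n ∧ x ∈ carrier s n then piece s γs h.choose x else 0

variable {γs : ℕ → ℝ → E}

theorem curve_eq_zero {x : ℝ} (hx : ∀ n, 1 ≤ n → x ∉ carrier s n) : curve s γs x = 0 :=
  dif_neg fun ⟨n, hn, h⟩ => hx n hn h

/-- On this closed interval no other carrier interferes, and outside the `n`-th carrier the cutoff
vanishes. -/
theorem curve_eq_piece (hs : ∀ n, 1 ≤ n → 0 < s n) {n : ℕ} (hn : 1 ≤ n) {x : ℝ}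
    (hx : x ∈ Icc (leftEnd s n) (leftEnd s (n + 1))) : curve s γs x = piece s γs n x := by
  by_cases h : ∃ m, 1 ≤ m ∧ x ∈ carrier s m
  · have he : h.choose = n := eq_of_mem_carrier hs h.choose_spec.1 hn h.choose_spec.2 hx
    rw [curve, dif_pos h, he]
  · push Not at h
    have hnpos : (0 : ℝ) < n := by exact_mod_cast hn
    rw [curve_eq_zero h, piece, cutoff_eq_zero (by positivity) (not_lt.1 (h n hn)), zero_smul]

theorem sub_centre_mem_Icc {n : ℕ} {x : ℝ} :
    x - centre s n ∈ Icc (-radius s n) (radius s n) ↔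
      x ∈ Icc (leftEnd s n) (leftEnd s (n + 1)) := by
  rw [mem_Icc, mem_Icc, leftEnd_succ, centre]
  constructor <;> rintro ⟨h, h'⟩ <;> constructor <;> linarith

theorem carrier_subset {n : ℕ} : carrier s n ⊆ Icc (leftEnd s n) (leftEnd s (n + 1)) :=
  fun _ hx => ⟨(leftEnd_lt_of_mem_carrier hx).le, (lt_leftEnd_of_mem_carrier hx).le⟩

theorem curve_centre_add (hs : ∀ n, 1 ≤ n → 0 < s n) {n : ℕ} (hn : 1 ≤ n) {u : ℝ}
    (hu : u ∈ Icc (-s n) (s n)) : curve s γs (centre s n + u) = γs n u := by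
  have hle : s n ≤ radius s n := le_add_of_nonneg_right (by positivity)
  have hmem : centre s n + u ∈ Icc (leftEnd s n) (leftEnd s (n + 1)) := by
    rw [← sub_centre_mem_Icc, add_sub_cancel_left]
    exact ⟨by linarith [hu.1], by linarith [hu.2]⟩
  rw [curve_eq_piece hs hn hmem, piece, add_sub_cancel_left, cutoff_eq_one (by positivity) hu,
    one_smul]

theorem range_curve_subset (hs : ∀ n, 1 ≤ n → 0 < s n) {r : ℕ → ℝ}
    (hr : ∀ n, 1 ≤ n → radius s n ≤ r n) :
    range (curve s γs) ⊆ Icc (0 : ℝ) 1 • ⋃ n ∈ Ici 1, γs n '' Icc (-r n) (r n) := by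
  have key : ∀ c ∈ Icc (0 : ℝ) 1, ∀ n, 1 ≤ n → ∀ u ∈ Icc (-radius s n) (radius s n),
      c • γs n u ∈ Icc (0 : ℝ) 1 • ⋃ n ∈ Ici 1, γs n '' Icc (-r n) (r n) := by
    intro c hc n hn u hu
    refine smul_mem_smul hc (mem_biUnion (show n ∈ Ici 1 from hn) ⟨u, ?_, rfl⟩)
    exact Icc_subset_Icc (neg_le_neg (hr n hn)) (hr n hn) hu
  rintro _ ⟨x, rfl⟩
  by_cases h : ∃ n, 1 ≤ n ∧ x ∈ carrier s n
  · obtain ⟨n, hn, hx⟩ := h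
    rw [curve_eq_piece hs hn (carrier_subset hx)]
    exact key _ (cutoff_mem_Icc _ _ _) n hn _ (sub_centre_mem_Icc.2 (carrier_subset hx))
  · push Not at h
    -- The value zero lies in the set as `0` times a value of the first curve.
    rw [curve_eq_zero h, ← zero_smul ℝ (γs 1 0)]
    have := radius_pos hs le_rfl
    exact key 0 ⟨le_rfl, zero_le_one⟩ 1 le_rfl 0 ⟨by linarith, this.le⟩

variable [TopologicalSpace E] [IsTopologicalAddGroup E] [ContinuousSMul ℝ E]

theorem exists_pow_mul_divDiff_curve_le (ι : Type*) [LinearOrder ι] {r : ℕ → ℝ} {Q : ℕ → E → ℝ}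
    (hs : ∀ n, 1 ≤ n → 0 < s n) (hr : ∀ n, 1 ≤ n → radius s n ≤ r n)
    (hQ : IsCalibration Q) (hsmooth : ∀ n, 1 ≤ n → IsSmooth (Icc (-r n) (r n)) (γs n))
    (hlim : ∀ k l m, Tendsto (fun n : ℕ => (n : ℝ≥0∞) ^ l *
      diffQuotSup (Q (n + m)) (Icc (-r n) (r n)) (γs n) k) atTop (𝓝 0)) (k l m : ℕ) :
    ∃ C, 0 ≤ C ∧ ∀ n : ℕ, 1 ≤ n → ∀ (J : Finset ι) (y : ι → ℝ), J.card = k + 1 → InjOn y J →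
      (∀ i ∈ J, ∀ p, 1 ≤ p → p < n → y i ∉ carrier s p) →
      (n : ℝ) ^ l * Q m (divDiff (curve s γs) J y) ≤ C := by
  refine exists_pow_mul_divDiff_le (I := fun n => Icc (leftEnd s n) (leftEnd s (n + 1))) hQ
    (fun t ht => curve_eq_zero ht) (fun n _ x hx y hy => le_abs_sub_of_mem_carrier hx hy)
    (fun k l m => ?_) k l m
  obtain ⟨C, hC0, hC⟩ := exists_pow_mul_divDiff_cutoff_smul_le ι hQ hsmooth hlim s k l m
  refine ⟨C, hC0, fun n hn J y hJ hy hyI => ?_⟩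
  have h1 : divDiff (curve s γs) J y = divDiff (fun t => cutoff ((n : ℝ) ^ 2) (s n) t • γs n t) J
      (fun i => y i - centre s n) := by
    rw [← divDiff_comp_sub]
    exact divDiff_congr fun i hi => curve_eq_piece hs hn (hyI i hi)
  rw [h1]
  refine hC n hn J _ hJ (fun i hi j hj h => hy hi hj (sub_left_injective h)) fun i hi => ?_
  exact Icc_subset_Icc (neg_le_neg (hr n hn)) (hr n hn) (sub_centre_mem_Icc.2 (hyI i hi))

end Curve

end CurveLemma

end

/-! ### Assembly: convergence at every point, and boundedness. -/

theorem theorem4p1 {E : Type*} [AddCommGroup E] [Module ℝ E] [TopologicalSpace E]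
    [IsTopologicalAddGroup E] [ContinuousSMul ℝ E] [T2Space E]
    (s r : ℕ → ℝ) (hs : ∀ n, 1 ≤ n → 0 < s n) (hr : ∀ n, 1 ≤ n → 0 < r n)
    (hsum : Summable s)
    (hrs : ∀ n : ℕ, 1 ≤ n → s n + 2 / (n : ℝ) ^ 2 ≤ r n)
    (γs : ℕ → ℝ → E)
    (hsmooth : ∀ n, 1 ≤ n → CurveLemma.IsSmooth (Icc (-r n) (r n)) (γs n))
    (hsmall : ∀ q : E → ℝ, CurveLemma.IsGauge q →
      ∃ Q : ℕ → E → ℝ, CurveLemma.IsCalibration Q ∧ Q 0 = q ∧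
        ∀ k l m : ℕ,
          Tendsto
            (fun n : ℕ => (n : ℝ≥0∞) ^ l *
              CurveLemma.diffQuotSup (Q (n + m)) (Icc (-r n) (r n)) (γs n) k)
            atTop (𝓝 0)) :
    ∃ γ : ℝ → E, CurveLemma.IsBCSmooth univ γ ∧
      range γ ⊆ Icc (0 : ℝ) 1 • ⋃ n ∈ Ici 1, γs n '' Icc (-r n) (r n) ∧
      ∃ t : ℕ → ℝ, (∃ T : ℝ, Tendsto t atTop (𝓝 T)) ∧
        ∀ n, 1 ≤ n → ∀ u ∈ Icc (-s n) (s n), γ (t n + u) = γs n u := by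
  open CurveLemma in
  have hest : ∀ q : E → ℝ, IsGauge q → ∀ k l : ℕ, ∃ C, 0 ≤ C ∧ ∀ n : ℕ, 1 ≤ n →
      ∀ y : Fin (k + 1) → ℝ, Function.Injective y →
      (∀ i, ∀ p, 1 ≤ p → p < n → y i ∉ carrier s p) →
      (n : ℝ) ^ l * q (divDiff (curve s γs) Finset.univ y) ≤ C := by
    intro q hq k l
    obtain ⟨Q, hQ, rfl, hlim⟩ := hsmall q hq
    obtain ⟨C, hC0, hC⟩ := exists_pow_mul_divDiff_curve_le (Fin (k + 1)) hs hrs hQ hsmooth hlim k l 0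
    exact ⟨C, hC0, fun n hn y hy hyS => hC n hn _ y (by simp) hy.injOn fun i _ => hyS i⟩
  have hconv : ∀ a, CurveLemma.DivDiffConverges (CurveLemma.curve s γs) a := by
    intro a
    by_cases hint : ∃ n, 1 ≤ n ∧ a ∈ Ioo (CurveLemma.leftEnd s n) (CurveLemma.leftEnd s (n + 1))
    · obtain ⟨n, hn, ha⟩ := hint
      have hmem : Icc (-r n) (r n) ∈ 𝓝 (a - CurveLemma.centre s n) := by
        have h1 := hrs n hn
        have h2 := ha.1
        have h3 := ha.2
        rw [CurveLemma.leftEnd_succ] at h3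
        refine Icc_mem_nhds ?_ ?_ <;> simp only [CurveLemma.centre, CurveLemma.radius] at * <;>
          linarith
      have h := (((CurveLemma.divDiffConverges_of_contDiff
        (CurveLemma.contDiff_cutoff ((n : ℝ) ^ 2) (s n)) _).smul
        ((hsmooth n hn).divDiffConverges hmem)).comp_sub)
      refine h.congr ?_
      filter_upwards [Ioo_mem_nhds ha.1 ha.2] with x hx
      exact (CurveLemma.curve_eq_piece hs hn (Ioo_subset_Icc_self hx)).symm
    push Not at hint
    by_cases ha : a = ∑' i, 2 * CurveLemma.radius s i
    swap
    · refine (CurveLemma.divDiffConverges_zero a).congr ?_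
      filter_upwards [CurveLemma.eventually_notMem_carrier hs hsum ha hint] with x hx
      exact (CurveLemma.curve_eq_zero hx).symm
    intro k
    refine ⟨0, tendsto_def.2 fun W hW => ?_⟩
    obtain ⟨q, hq, hqW⟩ := CurveLemma.exists_isGauge hW
    -- At the accumulation point, tuples close to `(a, …, a)` lie to the right of `leftEnd s n` and
    -- so avoid the first `n - 1` carriers. The weight `n ^ 1` with `n > C` then forces `q < 1`, so
    -- the limit is zero.
    obtain ⟨C, hC0, hC⟩ := hest q hq k 1
    obtain ⟨n, hn⟩ := exists_nat_gt C
    have hn0 : (0 : ℝ) < n := hC0.trans_lt hn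
    have hn1 : 1 ≤ n := by exact_mod_cast hn0
    have hev : ∀ᶠ y : Fin (k + 1) → ℝ in 𝓝 fun _ => a, ∀ i, CurveLemma.leftEnd s n < y i :=
      eventually_all.2 fun i => ((continuous_apply i).tendsto fun _ => a).eventually
        (Ioi_mem_nhds (ha ▸ CurveLemma.leftEnd_lt_tsum hs hsum hn1))
    filter_upwards [nhdsWithin_le_nhds hev, self_mem_nhdsWithin] with y hy hinj
    refine hqW _ ?_
    have h1 := hC n hn1 y hinj fun i p hp hpn hyp => lt_asymm (hy i)
      (lt_of_lt_of_le (CurveLemma.lt_leftEnd_of_mem_carrier hyp)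
        (CurveLemma.leftEnd_mono hs (by omega) hpn))
    rw [pow_one] at h1
    exact lt_of_mul_lt_mul_left (by linarith) hn0.le
  obtain ⟨hγ, hcl⟩ := CurveLemma.isSmooth_univ_of_tendsto
    (CurveLemma.exists_tendsto_divDiff fun a k => hconv a k)
  refine ⟨CurveLemma.curve s γs, ⟨hγ, fun k => ?_⟩, CurveLemma.range_curve_subset hs hrs,
    CurveLemma.centre s, ⟨_, CurveLemma.tendsto_centre hsum⟩,
    fun n hn u hu => CurveLemma.curve_centre_add hs hn hu⟩
  refine (Bornology.IsVonNBounded.closure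
    (CurveLemma.isVonNBounded_of_forall_isGauge fun q hq => ?_)).subset
    (by rintro _ ⟨x, -, rfl⟩; exact hcl k x)
  -- With `l = 0` and `n = 1` the avoidance condition is empty, so the bound is uniform over all
  -- injective tuples; passing to the closure covers the remaining ones.
  obtain ⟨C, -, hC⟩ := hest q hq k 0
  refine ⟨C, ?_⟩
  rintro _ ⟨y, hy, rfl⟩
  simpa using hC 1 le_rfl y hy fun i p hp hp' => absurd hp (by omega)
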